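/- Let $d\ge 1$, $\lambda>0$, and let $(a_\varepsilon)_{\varepsilon>0}$ be a family of coefficient fields in $M(\mathbb R^d,\lambda)$, i.e. each $a_\varepsilon:\mathbb R^d\to\mathbb R^{d\times d}$ is measurable and, for a.e. $x\in\mathbb R^d$ and all $\xi\in\mathbb R^d$, $\xi\cdot a_\varepsilon(x)\xi\ge\lambda|\xi|^2$ and $|a_\varepsilon(x)\xi|\le|\xi|$. Suppose that $(a_\varepsilon)$ admits homogenization with homogenized coefficients $a_{\hom}$; that is, $a_{\hom}\in\mathbb R^{d\times d}$ is a constant elliptic matrix (for some $\mu>0$, $\xi\cdot a_{\hom}\xi\ge\mu|\xi|^2$ for all $\xi\in\mathbb R^d$) and for every $i=1,\dots,d$ there are functions $g_{i,\varepsilon}\in H^1_{\mathrm{loc}}(\mathbb R^d)$, $\varepsilon>0$, such that, as $\varepsilon\downarrow0$ in (C2) and (C3), $$ \begin{aligned} \text{(C1)}\quad & -\nabla\cdot(a_\varepsilon^t\nabla g_{i,\varepsilon})=0 \ \text{ in } \mathcal D'(\mathbb R^d)\ \text{ for every } \varepsilon>0,\\ \text{(C2)}\quad & g_{i,\varepsilon}\rightharpoonup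 x_i \ \text{ weakly in } H^1_{\mathrm{loc}}(\mathbb R^d),\\ \text{(C3)}\quad & a_\varepsilon^t\nabla g_{i,\varepsilon}\rightharpoonup a_{\hom}^te_i \ \text{ weakly in } L^2_{\mathrm{loc}}(\mathbb R^d,\mathbb R^d). \end{aligned} $$ Let $O\subset\mathbb R^d$ be open and bounded, $f\in L^2(O)$ and $F\in L^2(O,\mathbb R^d)$. Then for every $\varepsilon>0$ there is a unique weak solution $u_\varepsilon\in H^1_0(O)$ to $-\nabla\cdot(a_\varepsilon\nabla u_\varepsilon)=f-\nabla\cdot F$ in $\mathcal D'(O)$, there is a unique weak solution $u_0\in H^1_0(O)$ to $-\nabla\cdot(a_{\hom}\nabla u_0)=f-\nabla\cdot F$ in $\mathcal D'(O)$, and, as $\varepsilon\downarrow 0$, $$u_\varepsilon\rightharpoonup u_0\ \text{ weakly in } H^1(O),\qquad a_\varepsilon\nabla u_\varepsilon\rightharpoonup a_{\hom}\nabla u_0\ \text{ weakly in } L^2(O,\mathbb R^d).$$ -/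

import Mathlib

open MeasureTheory Filter Topology
open scoped ContDiff Matrix

noncomputable section

namespace Homogenization

/-- The Euclidean space `ℝ^d`. -/
abbrev E (d : ℕ) : Type := EuclideanSpace ℝ (Fin d)

/-- The matrix-vector product on `ℝ^d`. -/
def mulVecE {d : ℕ} (A : Matrix (Fin d) (Fin d) ℝ) (ξ : E d) : E d :=
  Matrix.toEuclideanCLM (n := Fin d) (𝕜 := ℝ) A ξ

/-- The class `M(ℝ^d, lam)`: Lebesgue measurable matrix fields with
`ξ · a(x) ξ ≥ lam |ξ|²` and `|a(x) ξ| ≤ |ξ|` for almost every `x` and all `ξ`. -/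
structure UniformlyElliptic {d : ℕ} (lam : ℝ) (a : E d → Matrix (Fin d) (Fin d) ℝ) : Prop where
  measurable : ∀ i j, AEMeasurable (fun x => a x i j) volume
  bounds : ∀ᵐ x ∂(volume : Measure (E d)), ∀ ξ : E d,
    lam * ‖ξ‖ ^ 2 ≤ inner ℝ ξ (mulVecE (a x) ξ) ∧ ‖mulVecE (a x) ξ‖ ≤ ‖ξ‖

/-- Ellipticity of a constant (not necessarily symmetric) matrix. -/
def IsElliptic {d : ℕ} (A : Matrix (Fin d) (Fin d) ℝ) : Prop :=
  ∃ μ : ℝ, 0 < μ ∧ ∀ ξ : E d, μ * ‖ξ‖ ^ 2 ≤ inner ℝ ξ (mulVecE A ξ)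

/-- Test functions: `φ ∈ C_c^∞(O)`. -/
structure IsTest {d : ℕ} (O : Set (E d)) (φ : E d → ℝ) : Prop where
  smooth : ContDiff ℝ ∞ φ
  compact : HasCompactSupport φ
  support : tsupport φ ⊆ O

/-- `G` is the weak gradient of `u` in `O`. -/
def IsWeakGradient {d : ℕ} (O : Set (E d)) (u : E d → ℝ) (G : E d → E d) : Prop :=
  ∀ φ : E d → ℝ, IsTest O φ →
    ∫ x in O, u x • gradient φ x = - ∫ x in O, φ x • G x

theorem IsTest.continuous_gradient {d : ℕ} {O : Set (E d)} {φ : E d → ℝ} (h : IsTest O φ) :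
    Continuous (gradient φ) :=
  (InnerProductSpace.toDual ℝ (E d)).symm.continuous.comp
    (h.smooth.continuous_fderiv (by simp))

theorem IsTest.hasCompactSupport_gradient {d : ℕ} {O : Set (E d)} {φ : E d → ℝ}
    (h : IsTest O φ) : HasCompactSupport (gradient φ) :=
  (h.compact.fderiv (𝕜 := ℝ)).comp_left (g := (InnerProductSpace.toDual ℝ (E d)).symm)
    (map_zero _)

theorem IsTest.memLp {d : ℕ} {O : Set (E d)} {φ : E d → ℝ} (h : IsTest O φ) :
    MemLp φ 2 (volume.restrict O) :=
  (h.smooth.continuous.memLp_of_hasCompactSupport h.compact).restrict O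

theorem IsTest.memLp_gradient {d : ℕ} {O : Set (E d)} {φ : E d → ℝ} (h : IsTest O φ) :
    MemLp (gradient φ) 2 (volume.restrict O) :=
  (h.continuous_gradient.memLp_of_hasCompactSupport h.hasCompactSupport_gradient).restrict O

/-- `L²(O)`. -/
abbrev L2 {d : ℕ} (O : Set (E d)) : Type := Lp ℝ 2 (volume.restrict O)

/-- `L²(O, ℝ^d)`. -/
abbrev L2v {d : ℕ} (O : Set (E d)) : Type := Lp (E d) 2 (volume.restrict O)

/-- The Sobolev space `H¹(O)`: pairs `(u, ∇u)` of an `L²` function and its weak gradient in `L²`,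
with the norm `(‖u‖² + ‖∇u‖²)^{1/2}`. -/
def H1 {d : ℕ} (O : Set (E d)) : Submodule ℝ (WithLp 2 (L2 O × L2v O)) where
  carrier := {p | IsWeakGradient O p.fst p.snd}
  zero_mem' := by
    intro φ hφ
    have h1 : ∀ᵐ x ∂(volume.restrict O), ((0 : L2 O) : E d → ℝ) x • gradient φ x = 0 := by
      filter_upwards [Lp.coeFn_zero ℝ 2 (volume.restrict O)] with x hx
      rw [hx, Pi.zero_apply, zero_smul]
    have h2 : ∀ᵐ x ∂(volume.restrict O), φ x • ((0 : L2v O) : E d → E d) x = 0 := by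
      filter_upwards [Lp.coeFn_zero (E d) 2 (volume.restrict O)] with x hx
      rw [hx, Pi.zero_apply, smul_zero]
    simp only [WithLp.zero_fst, WithLp.zero_snd]
    rw [integral_congr_ae h1, integral_congr_ae h2]
    simp
  add_mem' := by
    intro p q hp hq φ hφ
    have h1 : ∀ᵐ x ∂(volume.restrict O), ((p.fst + q.fst : L2 O) : E d → ℝ) x • gradient φ x
        = p.fst x • gradient φ x + q.fst x • gradient φ x := by
      filter_upwards [Lp.coeFn_add p.fst q.fst] with x hx
      rw [hx, Pi.add_apply, add_smul]
    have h2 : ∀ᵐ x ∂(volume.restrict O), φ x • ((p.snd + q.snd : L2v O) : E d → E d) x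
        = φ x • p.snd x + φ x • q.snd x := by
      filter_upwards [Lp.coeFn_add p.snd q.snd] with x hx
      rw [hx, Pi.add_apply, smul_add]
    have i1 : ∀ r : L2 O, Integrable (fun x => r x • gradient φ x) (volume.restrict O) :=
      fun r => memLp_one_iff_integrable.1 (hφ.memLp_gradient.smul (Lp.memLp r))
    have i2 : ∀ r : L2v O, Integrable (fun x => φ x • r x) (volume.restrict O) :=
      fun r => memLp_one_iff_integrable.1 ((Lp.memLp r).smul hφ.memLp)
    simp only [WithLp.add_fst, WithLp.add_snd]
    rw [integral_congr_ae h1, integral_congr_ae h2, integral_add (i1 _) (i1 _),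
      integral_add (i2 _) (i2 _), hp φ hφ, hq φ hφ, neg_add]
  smul_mem' := by
    intro c p hp φ hφ
    have h1 : ∀ᵐ x ∂(volume.restrict O), ((c • p.fst : L2 O) : E d → ℝ) x • gradient φ x
        = c • (p.fst x • gradient φ x) := by
      filter_upwards [Lp.coeFn_smul c p.fst] with x hx
      rw [hx, Pi.smul_apply, smul_assoc]
    have h2 : ∀ᵐ x ∂(volume.restrict O), φ x • ((c • p.snd : L2v O) : E d → E d) x
        = c • (φ x • p.snd x) := by
      filter_upwards [Lp.coeFn_smul c p.snd] with x hx
      rw [hx, Pi.smul_apply]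
      exact smul_comm _ _ _
    simp only [WithLp.smul_fst, WithLp.smul_snd]
    rw [integral_congr_ae h1, integral_congr_ae h2, integral_smul, integral_smul, hp φ hφ,
      smul_neg]

/-- The function underlying an element of `H¹(O)`. -/
def fn {d : ℕ} {O : Set (E d)} (u : H1 O) : L2 O := u.1.fst

/-- The weak gradient of an element of `H¹(O)`. -/
def wgrad {d : ℕ} {O : Set (E d)} (u : H1 O) : L2v O := u.1.snd

/-- The (classes of) test functions inside `H¹(O)`. -/
def testFunctions {d : ℕ} (O : Set (E d)) : Set (H1 O) :=
  {u | ∃ φ : E d → ℝ, IsTest O φ ∧ fn u =ᵐ[volume.restrict O] φ ∧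
    wgrad u =ᵐ[volume.restrict O] gradient φ}

/-- `H¹₀(O)`: the closure of `C_c^∞(O)` in `H¹(O)`. -/
def H10 {d : ℕ} (O : Set (E d)) : Set (H1 O) := closure (testFunctions O)

/-- `u ∈ H¹₀(O)` is a weak solution of `-∇·(a ∇u) = f - ∇·F` in `𝒟'(O)`. -/
structure IsDirichletSolution {d : ℕ} {O : Set (E d)} (a : E d → Matrix (Fin d) (Fin d) ℝ)
    (f : L2 O) (F : L2v O) (u : H1 O) : Prop where
  mem_H10 : u ∈ H10 O
  equation : ∀ φ : E d → ℝ, IsTest O φ →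
    ∫ x in O, inner ℝ (mulVecE (a x) (wgrad u x)) (gradient φ x)
      = ∫ x in O, (f x * φ x + inner ℝ (F x) (gradient φ x))

/-- Weak convergence `u ε ⇀ u₀` in the Hilbert space `H¹(O)` as `ε ↓ 0`. -/
def TendstoWeaklyH1 {d : ℕ} {O : Set (E d)} (u : ℝ → H1 O) (u₀ : H1 O) : Prop :=
  Tendsto (fun ε => toWeakSpace ℝ (H1 O) (u ε)) (𝓝[>] 0) (𝓝 (toWeakSpace ℝ (H1 O) u₀))

/-- Weak convergence `F ε ⇀ F₀` in `L²(O, ℝ^d)` as `ε ↓ 0`, for a family indexed by `ε > 0`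
of concrete vector fields. -/
structure TendstoWeaklyL2 {d : ℕ} (O : Set (E d)) (F : ℝ → E d → E d) (F₀ : E d → E d) :
    Prop where
  memLp : ∀ ε : ℝ, 0 < ε → MemLp (F ε) 2 (volume.restrict O)
  memLp_limit : MemLp F₀ 2 (volume.restrict O)
  tendsto : ∀ ψ : E d → E d, MemLp ψ 2 (volume.restrict O) →
    Tendsto (fun ε => ∫ x in O, inner ℝ (F ε x) (ψ x)) (𝓝[>] 0)
      (𝓝 (∫ x in O, inner ℝ (F₀ x) (ψ x)))

/-- Weak convergence in `L²_loc(ℝ^d, ℝ^d)`: weak convergence in `L²(U, ℝ^d)` for every bounded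
open `U`. -/
def TendstoWeaklyL2loc {d : ℕ} (F : ℝ → E d → E d) (F₀ : E d → E d) : Prop :=
  ∀ U : Set (E d), IsOpen U → Bornology.IsBounded U → TendstoWeaklyL2 U F F₀

/-- `H¹_loc(ℝ^d)`: functions in `L²_loc` with a weak gradient in `L²_loc`. -/
structure H1loc (d : ℕ) where
  /-- the function -/
  val : E d → ℝ
  /-- its weak gradient -/
  grad : E d → E d
  memLp_val : ∀ K : Set (E d), IsCompact K → MemLp val 2 (volume.restrict K)
  memLp_grad : ∀ K : Set (E d), IsCompact K → MemLp grad 2 (volume.restrict K)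
  isWeakGradient : IsWeakGradient Set.univ val grad

theorem H1loc.memLp_val_of_isBounded {d : ℕ} (g : H1loc d) {U : Set (E d)}
    (hU : Bornology.IsBounded U) : MemLp g.val 2 (volume.restrict U) :=
  (g.memLp_val _ hU.isCompact_closure).mono_measure (Measure.restrict_mono subset_closure le_rfl)

theorem H1loc.memLp_grad_of_isBounded {d : ℕ} (g : H1loc d) {U : Set (E d)}
    (hU : Bornology.IsBounded U) : MemLp g.grad 2 (volume.restrict U) :=
  (g.memLp_grad _ hU.isCompact_closure).mono_measure (Measure.restrict_mono subset_closure le_rfl)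

theorem H1loc.isWeakGradient_restrict {d : ℕ} (g : H1loc d) (U : Set (E d)) :
    IsWeakGradient U g.val g.grad := by
  intro φ hφ
  have h := g.isWeakGradient φ ⟨hφ.smooth, hφ.compact, Set.subset_univ _⟩
  have h0 : ∀ x, x ∉ U → φ x = 0 := fun x hx =>
    image_eq_zero_of_notMem_tsupport fun hx' => hx (hφ.support hx')
  have h1 : ∀ x, x ∉ U → gradient φ x = 0 := by
    intro x hx
    have : fderiv ℝ φ x = 0 := by
      by_contra hne
      exact hx (hφ.support (support_fderiv_subset ℝ hne))
    simp [gradient, this]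
  rw [setIntegral_univ, setIntegral_univ] at h
  rw [setIntegral_eq_integral_of_forall_compl_eq_zero (fun x hx => by simp [h1 x hx]),
    setIntegral_eq_integral_of_forall_compl_eq_zero (fun x hx => by simp [h0 x hx]), h]

/-- The restriction of an element of `H¹_loc(ℝ^d)` to a bounded set, as an element of `H¹(U)`. -/
def H1loc.restrict {d : ℕ} (g : H1loc d) (U : Set (E d)) (hU : Bornology.IsBounded U) : H1 U :=
  ⟨WithLp.toLp 2 ((g.memLp_val_of_isBounded hU).toLp g.val,
      (g.memLp_grad_of_isBounded hU).toLp g.grad), by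
    intro φ hφ
    have h1 : ∀ᵐ x ∂(volume.restrict U),
        (g.memLp_val_of_isBounded hU).toLp g.val x • gradient φ x = g.val x • gradient φ x := by
      filter_upwards [(g.memLp_val_of_isBounded hU).coeFn_toLp] with x hx
      rw [hx]
    have h2 : ∀ᵐ x ∂(volume.restrict U),
        φ x • (g.memLp_grad_of_isBounded hU).toLp g.grad x = φ x • g.grad x := by
      filter_upwards [(g.memLp_grad_of_isBounded hU).coeFn_toLp] with x hx
      rw [hx]
    refine (integral_congr_ae h1).trans ?_
    refine Eq.trans ?_ (congrArg Neg.neg (integral_congr_ae h2).symm)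
    exact g.isWeakGradient_restrict U φ hφ⟩

/-- Weak convergence in `H¹_loc(ℝ^d)`: weak convergence of the restrictions in `H¹(U)` for every
bounded open `U`. -/
def TendstoWeaklyH1loc {d : ℕ} (g : ℝ → H1loc d) (g₀ : H1loc d) : Prop :=
  ∀ (U : Set (E d)) (_ : IsOpen U) (hU : Bornology.IsBounded U),
    TendstoWeaklyH1 (fun ε => (g ε).restrict U hU) (g₀.restrict U hU)

theorem integral_coord_smul_gradient {d : ℕ} (i : Fin d) (φ : E d → ℝ)
    (hφ : IsTest Set.univ φ) :
    ∫ x : E d, x i • gradient φ x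
      = - ∫ x : E d, φ x • (EuclideanSpace.single i 1 : E d) := by
  have hc : Continuous fun x : E d => x i := (EuclideanSpace.proj (𝕜 := ℝ) i).continuous
  have hd : ∀ x : E d, HasFDerivAt (fun x : E d => x i) (EuclideanSpace.proj (𝕜 := ℝ) i) x :=
    fun x => (EuclideanSpace.proj (𝕜 := ℝ) i : E d →L[ℝ] ℝ).hasFDerivAt
  have I1 : Integrable (fun x : E d => x i • gradient φ x) volume :=
    (hc.smul hφ.continuous_gradient).integrable_of_hasCompactSupport
      hφ.hasCompactSupport_gradient.smul_left
  have I2 : Integrable (fun x : E d => φ x • (EuclideanSpace.single i 1 : E d)) volume :=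
    (hφ.smooth.continuous.smul continuous_const).integrable_of_hasCompactSupport
      hφ.compact.smul_right
  have I3 : Integrable φ volume :=
    hφ.smooth.continuous.integrable_of_hasCompactSupport hφ.compact
  refine ext_inner_left ℝ fun v => ?_
  rw [inner_neg_right, ← integral_inner I1, ← integral_inner I2]
  have hg : ∀ x, inner ℝ v (gradient φ x) = fderiv ℝ φ x v := fun x => by
    rw [real_inner_comm, inner_gradient_left]
  have key := integral_mul_fderiv_eq_neg_fderiv_mul_of_integrable (μ := (volume : Measure (E d)))
    (f := fun x : E d => x i) (g := φ) (v := v)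
    (by simpa [(hd _).fderiv] using I3.const_mul (v i))
    (by simpa only [inner_smul_right, hg] using I1.const_inner (𝕜 := ℝ) v)
    ((hc.mul hφ.smooth.continuous).integrable_of_hasCompactSupport hφ.compact.mul_left)
    (fun x _ => (hd x).differentiableAt)
    (fun x _ => hφ.smooth.differentiable (by simp) x)
  simp only [inner_smul_right, hg]
  rw [key]
  congr 1
  refine integral_congr_ae (Eventually.of_forall fun x => ?_)
  simp [(hd x).fderiv, EuclideanSpace.inner_single_right, mul_comm]

/-- The coordinate function `x ↦ x_i` as an element of `H¹_loc(ℝ^d)`. -/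
def coord {d : ℕ} (i : Fin d) : H1loc d where
  val := fun x => x i
  grad := fun _ => EuclideanSpace.single i 1
  memLp_val := fun K hK => by
    have hc : Continuous fun x : E d => x i := (EuclideanSpace.proj (𝕜 := ℝ) i).continuous
    obtain ⟨C, hC⟩ := hK.exists_bound_of_continuousOn hc.continuousOn
    have : IsFiniteMeasure ((volume : Measure (E d)).restrict K) :=
      ⟨by simpa using hK.measure_lt_top⟩
    exact MemLp.of_bound hc.aestronglyMeasurable C
      ((ae_restrict_iff' hK.measurableSet).2 (Eventually.of_forall hC))
  memLp_grad := fun K hK => by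
    have : IsFiniteMeasure ((volume : Measure (E d)).restrict K) :=
      ⟨by simpa using hK.measure_lt_top⟩
    exact memLp_const _
  isWeakGradient := fun φ hφ => by
    rw [setIntegral_univ, setIntegral_univ]
    exact integral_coord_smul_gradient i φ hφ

/-- The family `(a ε)_{ε > 0}` admits homogenization with the homogenized coefficients `ahom`:
`ahom` is elliptic, and for every `i` there are oscillating test functions `g ε` in
`H¹_loc(ℝ^d)`, `ε > 0`, satisfying the three conditions below. -/
structure AdmitsHomogenization {d : ℕ} (a : ℝ → E d → Matrix (Fin d) (Fin d) ℝ)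
    (ahom : Matrix (Fin d) (Fin d) ℝ) : Prop where
  elliptic : IsElliptic ahom
  exists_oscillating : ∀ i : Fin d, ∃ g : ℝ → H1loc d,
    -- `-∇·(aᵗ_ε ∇g_ε) = 0` in `𝒟'(ℝ^d)`
    (∀ ε : ℝ, 0 < ε → ∀ φ : E d → ℝ, IsTest Set.univ φ →
      ∫ x, inner ℝ (mulVecE (a ε x)ᵀ ((g ε).grad x)) (gradient φ x) = 0) ∧
    -- `g_ε ⇀ x_i` weakly in `H¹_loc(ℝ^d)`
    TendstoWeaklyH1loc g (coord i) ∧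
    -- `aᵗ_ε ∇g_ε ⇀ aᵗ_hom e_i` weakly in `L²_loc(ℝ^d)`
    TendstoWeaklyL2loc (fun ε x => mulVecE (a ε x)ᵀ ((g ε).grad x))
      (fun _ => mulVecE ahomᵀ (EuclideanSpace.single i 1))

end Homogenization

end

/-! The proof is Tartar's method of oscillating test functions. On `H10 O` the Poincaré inequality
(`exists_poincare`) makes the Dirichlet forms coercive, so Lax–Milgram (`existsUnique_of_coercive`)
solves each problem, and `norm_le_of_variational` bounds the solutions uniformly in ε. Hence along
any sequence ε → 0 there is a subsequence with solutions u ⇀ w and fluxes s = a∇u ⇀ σ, and the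
equation passes to the limit with σ as flux. Everything hinges on σ = `ahom`∇w (`limit_flux_eq`):
then w solves the homogenized problem, so w = u₀ by uniqueness, and since the limit does not depend
on the subsequence the whole family converges (`tendsto_nhdsGT_of_subseq`).

To identify σ, put t = aᵗ∇g for the oscillating function g of direction i and let φ be a test
function. Test the equation of u with φg and that of g with φu. Because s·∇g = t·∇u pointwise, the
products of two weakly convergent gradients cancel on subtraction, leaving ∫ s·g∇φ − ∫ t·u∇φ =
ℓ(φg). Each remaining integral pairs a weakly convergent flux with a strongly convergent function,
by Rellich's theorem. Comparing the limit with the limit equations tested with φx_i and φw gives ∫ φ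
σ·e_i = ∫ φ (`ahom`ᵗe_i)·∇w, which is the claim since φ and i are arbitrary; this is
`inner_smul_limit_eq`.

No regularity of the boundary of O enters: functions outside `H10 O` are only used after
multiplication by a test function, which puts them into `H10 O` (`mem_H10_of_ae_eq_mul`), where
Rellich's theorem holds (`tendsto_fn_of_mem_H10`). -/

noncomputable section

namespace Homogenization

/-! ### Weak convergence in Hilbert spaces -/

section Hilbert

variable {ι H K : Type*} [NormedAddCommGroup H] [InnerProductSpace ℝ H]
  [NormedAddCommGroup K] [InnerProductSpace ℝ K]

/-- Weak convergence in an inner product space, tested against the elements of the space. -/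
def WeaklyTendsto (x : ι → H) (l : Filter ι) (x₀ : H) : Prop :=
  ∀ y : H, Tendsto (fun i => inner ℝ (x i) y) l (𝓝 (inner ℝ x₀ y))

/-- By Riesz every functional is an inner product. Injectivity of the flipped pairing is what
reduces convergence in the weak topology to convergence of each functional. -/
theorem tendsto_toWeakSpace_iff [CompleteSpace H] {x : ι → H} {l : Filter ι} {x₀ : H} :
    Tendsto (fun i => toWeakSpace ℝ H (x i)) l (𝓝 (toWeakSpace ℝ H x₀)) ↔
      WeaklyTendsto x l x₀ := by
  have hinj : Function.Injective ((topDualPairing ℝ H).flip) := by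
    intro u v huv
    refine ext_inner_left ℝ fun w => ?_
    have := congrArg (fun g => g (InnerProductSpace.toDual ℝ H w)) huv
    simpa using this
  refine (WeakBilin.tendsto_iff_forall_eval_tendsto _ hinj).trans ?_
  constructor
  · intro h y
    have := h (InnerProductSpace.toDual ℝ H y)
    simp only [real_inner_comm y]
    exact this
  · intro h y
    have := h ((InnerProductSpace.toDual ℝ H).symm y)
    simp only [real_inner_comm ((InnerProductSpace.toDual ℝ H).symm y),
      InnerProductSpace.toDual_symm_apply] at this
    exact this

theorem WeaklyTendsto.comp {κ : Type*} {x : ι → H} {l : Filter ι} {x₀ : H}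
    (h : WeaklyTendsto x l x₀) {s : κ → ι} {m : Filter κ} (hs : Tendsto s m l) :
    WeaklyTendsto (fun k => x (s k)) m x₀ :=
  fun y => (h y).comp hs

theorem WeaklyTendsto.unique {x : ι → H} {l : Filter ι} [l.NeBot] {x₀ x₁ : H}
    (h : WeaklyTendsto x l x₀) (h' : WeaklyTendsto x l x₁) : x₀ = x₁ :=
  ext_inner_right ℝ fun y => tendsto_nhds_unique (h y) (h' y)

theorem WeaklyTendsto.map [CompleteSpace H] [CompleteSpace K] {x : ι → H} {l : Filter ι} {x₀ : H}
    (h : WeaklyTendsto x l x₀) (T : H →L[ℝ] K) : WeaklyTendsto (fun i => T (x i)) l (T x₀) := by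
  intro y
  simpa only [ContinuousLinearMap.adjoint_inner_right] using h (ContinuousLinearMap.adjoint T y)

theorem WeaklyTendsto.sub {x y : ι → H} {l : Filter ι} {x₀ y₀ : H}
    (hx : WeaklyTendsto x l x₀) (hy : WeaklyTendsto y l y₀) :
    WeaklyTendsto (fun i => x i - y i) l (x₀ - y₀) := by
  intro z
  simpa only [inner_sub_left] using (hx z).sub (hy z)

theorem weaklyTendsto_of_tendsto {x : ι → H} {l : Filter ι} {x₀ : H} (h : Tendsto x l (𝓝 x₀)) :
    WeaklyTendsto x l x₀ :=
  fun _ => h.inner tendsto_const_nhds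

/-- Uniform boundedness principle. It needs sequences: a convergent real sequence is bounded,
whereas convergence along a general filter bounds values only eventually. -/
theorem WeaklyTendsto.exists_norm_le [CompleteSpace H] {x : ℕ → H} {x₀ : H}
    (h : WeaklyTendsto x atTop x₀) : ∃ C : ℝ, ∀ n, ‖x n‖ ≤ C := by
  obtain ⟨C, hC⟩ := banach_steinhaus (g := fun n => InnerProductSpace.toDual ℝ H (x n)) (by
    intro y
    obtain ⟨C, hC⟩ := (Metric.isBounded_range_of_tendsto _ (h y)).exists_norm_le
    exact ⟨C, fun n => by simpa using hC _ ⟨n, rfl⟩⟩)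
  exact ⟨C, fun n => by simpa using hC n⟩

theorem WeaklyTendsto.inner_tendsto [CompleteSpace H] {x y : ℕ → H} {x₀ y₀ : H}
    (hx : WeaklyTendsto x atTop x₀) (hy : Tendsto y atTop (𝓝 y₀)) :
    Tendsto (fun n => inner ℝ (x n) (y n)) atTop (𝓝 (inner ℝ x₀ y₀)) := by
  obtain ⟨C, hC⟩ := hx.exists_norm_le
  have h1 : Tendsto (fun n => inner ℝ (x n) (y n - y₀)) atTop (𝓝 0) := by
    have h2 : Tendsto (fun n => C * ‖y n - y₀‖) atTop (𝓝 0) := by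
      simpa using (tendsto_iff_norm_sub_tendsto_zero.1 hy).const_mul C
    refine squeeze_zero_norm (fun n => ?_) h2
    exact (norm_inner_le_norm _ _).trans (mul_le_mul_of_nonneg_right (hC n) (norm_nonneg _))
  have := h1.add (hx y₀)
  simpa [inner_sub_right] using this

/-- A closed subspace is its double orthogonal complement, and orthogonality to a fixed vector
survives weak limits. -/
theorem WeaklyTendsto.mem_of_isClosed [CompleteSpace H] {x : ι → H} {l : Filter ι} [l.NeBot]
    {x₀ : H} (h : WeaklyTendsto x l x₀) (V : Submodule ℝ H) (hV : IsClosed (V : Set H))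
    (hx : ∀ i, x i ∈ V) : x₀ ∈ V := by
  have : CompleteSpace V := hV.completeSpace_coe
  rw [← Submodule.orthogonal_orthogonal V]
  intro y hy
  have h0 : ∀ i, inner ℝ (x i) y = 0 := fun i => hy (x i) (hx i)
  have := tendsto_nhds_unique (h y) (tendsto_const_nhds.congr fun i => (h0 i).symm)
  rw [real_inner_comm, this]

/-- Sequential Banach–Alaoglu in the separable dual picture, transported by the Riesz isomorphism.
-/
theorem exists_subseq_weaklyTendsto [CompleteSpace H] [TopologicalSpace.SeparableSpace H]
    {x : ℕ → H} {C : ℝ} (hx : ∀ n, ‖x n‖ ≤ C) :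
    ∃ (x₀ : H) (s : ℕ → ℕ), StrictMono s ∧ WeaklyTendsto (fun n => x (s n)) atTop x₀ := by
  obtain ⟨y, -, s, hs, hy⟩ := WeakDual.isSeqCompact_closedBall ℝ H 0 C
    (x := fun n => StrongDual.toWeakDual (InnerProductSpace.toDual ℝ H (x n))) (by
      intro n
      simpa using hx n)
  refine ⟨(InnerProductSpace.toDual ℝ H).symm (WeakDual.toStrongDual y), s, hs, fun z => ?_⟩
  rw [tendsto_iff_forall_eval_tendsto_topDualPairing] at hy
  have := hy z
  rw [InnerProductSpace.toDual_symm_apply]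
  exact this

end Hilbert

/-! ### Pointwise multiplication operators on L² -/

/-- Common source of multiplication by coefficient fields, by cutoffs and by gradients of cutoffs.
As bounded operators they preserve weak convergence. -/
theorem exists_pointwise_clm {α F G : Type*} [MeasurableSpace α] {μ : Measure α}
    [NormedAddCommGroup F] [NormedSpace ℝ F] [NormedAddCommGroup G] [NormedSpace ℝ G]
    (Φ : α → F →ₗ[ℝ] G) (C : ℝ)
    (hm : ∀ f : α → F, AEStronglyMeasurable f μ → AEStronglyMeasurable (fun x => Φ x (f x)) μ)
    (hC : ∀ᵐ x ∂μ, ∀ ξ, ‖Φ x ξ‖ ≤ C * ‖ξ‖) :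
    ∃ T : Lp F 2 μ →L[ℝ] Lp G 2 μ, (∀ f : Lp F 2 μ, T f =ᵐ[μ] fun x => Φ x (f x)) ∧
      ∀ f, ‖T f‖ ≤ C * ‖f‖ := by
  have hL : ∀ f : Lp F 2 μ, MemLp (fun x => Φ x (f x)) 2 μ := fun f =>
    (Lp.memLp f).of_le_mul (hm _ (Lp.memLp f).1) (hC.mono fun x hx => hx (f x))
  let T₀ : Lp F 2 μ →ₗ[ℝ] Lp G 2 μ :=
    { toFun := fun f => (hL f).toLp _
      map_add' := fun f g => by
        rw [← MemLp.toLp_add]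
        refine MemLp.toLp_congr _ _ ?_
        filter_upwards [Lp.coeFn_add f g] with x hx
        rw [hx, Pi.add_apply, map_add, Pi.add_apply]
      map_smul' := fun c f => by
        rw [RingHom.id_apply, ← MemLp.toLp_const_smul]
        refine MemLp.toLp_congr _ _ ?_
        filter_upwards [Lp.coeFn_smul c f] with x hx
        rw [hx, Pi.smul_apply, map_smul, Pi.smul_apply] }
  have hT₀ : ∀ f, T₀ f =ᵐ[μ] fun x => Φ x (f x) := fun f => (hL f).coeFn_toLp
  have hb : ∀ f, ‖T₀ f‖ ≤ C * ‖f‖ := fun f =>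
    Lp.norm_le_mul_norm_of_ae_le_mul (by
      filter_upwards [hT₀ f, hC] with x hx hCx
      rw [hx]; exact hCx _)
  exact ⟨T₀.mkContinuous C hb, hT₀, hb⟩

variable {d : ℕ} {O : Set (E d)}

theorem mulVecE_apply (A : Matrix (Fin d) (Fin d) ℝ) (ξ : E d) (i : Fin d) :
    mulVecE A ξ i = ∑ j, A i j * ξ j := by
  simp [mulVecE, Matrix.mulVec, dotProduct]

theorem inner_mulVecE_transpose (A : Matrix (Fin d) (Fin d) ℝ) (ξ η : E d) :
    inner ℝ (mulVecE Aᵀ ξ) η = inner ℝ ξ (mulVecE A η) := by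
  simp only [PiLp.inner_apply, mulVecE_apply, Matrix.transpose_apply, RCLike.inner_apply, conj_trivial,
    Finset.mul_sum, Finset.sum_mul]
  rw [Finset.sum_comm]
  exact Finset.sum_congr rfl fun i _ => Finset.sum_congr rfl fun j _ => by ring

theorem aestronglyMeasurable_mulVecE {a : E d → Matrix (Fin d) (Fin d) ℝ} {μ : Measure (E d)}
    (ha : ∀ i j, AEMeasurable (fun x => a x i j) μ) {G : E d → E d}
    (hG : AEStronglyMeasurable G μ) :
    AEStronglyMeasurable (fun x => mulVecE (a x) (G x)) μ := by
  have h : AEMeasurable (fun x => (fun i => ∑ j, a x i j * G x j : Fin d → ℝ)) μ := by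
    refine aemeasurable_pi_lambda _ fun i => ?_
    refine Finset.aemeasurable_fun_sum _ fun j _ => (ha i j).mul ?_
    exact (EuclideanSpace.proj (𝕜 := ℝ) j).continuous.measurable.comp_aemeasurable hG.aemeasurable
  have h2 := (EuclideanSpace.equiv (Fin d) ℝ).symm.continuous.measurable.comp_aemeasurable h
  refine h2.aestronglyMeasurable.congr (Eventually.of_forall fun x => ?_)
  ext i
  simp [mulVecE_apply]

theorem exists_field_clm {a : E d → Matrix (Fin d) (Fin d) ℝ} {C : ℝ}
    (ha : ∀ i j, AEMeasurable (fun x => a x i j) volume)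
    (hC : ∀ᵐ x ∂(volume : Measure (E d)), ∀ ξ : E d, ‖mulVecE (a x) ξ‖ ≤ C * ‖ξ‖) :
    ∃ T : L2v O →L[ℝ] L2v O,
      (∀ G : L2v O, T G =ᵐ[volume.restrict O] fun x => mulVecE (a x) (G x)) ∧
      ∀ G, ‖T G‖ ≤ C * ‖G‖ :=
  exists_pointwise_clm (fun x => (Matrix.toEuclideanCLM (n := Fin d) (𝕜 := ℝ) (a x)).toLinearMap)
    C (fun _ hG => aestronglyMeasurable_mulVecE (fun i j => (ha i j).restrict) hG)
    (ae_restrict_of_ae hC)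

theorem inner_eq_integral {F : Type*} [NormedAddCommGroup F] [InnerProductSpace ℝ F]
    {f g : Lp F 2 (volume.restrict O)} {f' g' : E d → F} (hf : f =ᵐ[volume.restrict O] f')
    (hg : g =ᵐ[volume.restrict O] g') :
    inner ℝ f g = ∫ x in O, inner ℝ (f' x) (g' x) := by
  rw [L2.inner_def]
  refine integral_congr_ae ?_
  filter_upwards [hf, hg] with x h1 h2
  rw [h1, h2]

theorem mul_norm_sq_le_inner {a : E d → Matrix (Fin d) (Fin d) ℝ} {c : ℝ}
    (hc : ∀ᵐ x ∂(volume : Measure (E d)), ∀ ξ : E d,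
      c * ‖ξ‖ ^ 2 ≤ inner ℝ ξ (mulVecE (a x) ξ))
    {G T : L2v O} (hT : T =ᵐ[volume.restrict O] fun x => mulVecE (a x) (G x)) :
    c * ‖G‖ ^ 2 ≤ inner ℝ T G := by
  rw [← real_inner_self_eq_norm_sq, L2.inner_def, L2.inner_def, ← integral_const_mul]
  refine integral_mono_ae ((L2.integrable_inner G G).const_mul c) (L2.integrable_inner T G) ?_
  filter_upwards [hT, ae_restrict_of_ae hc] with x h1 h2
  have := h2 (G x)
  rw [h1, real_inner_self_eq_norm_sq, real_inner_comm]
  exact this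

/-! ### Test functions -/

theorem IsTest.differentiable {φ : E d → ℝ} (h : IsTest O φ) : Differentiable ℝ φ :=
  h.smooth.differentiable (by simp)

theorem gradient_eq_zero_of_fderiv_eq_zero {φ : E d → ℝ} {x : E d} (h : fderiv ℝ φ x = 0) :
    gradient φ x = 0 := by
  simp [gradient, h]

theorem IsTest.eq_zero {φ : E d → ℝ} (h : IsTest O φ) {x : E d} (hx : x ∉ O) : φ x = 0 :=
  image_eq_zero_of_notMem_tsupport fun hx' => hx (h.support hx')

theorem IsTest.gradient_eq_zero {φ : E d → ℝ} (h : IsTest O φ) {x : E d} (hx : x ∉ O) :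
    gradient φ x = 0 :=
  gradient_eq_zero_of_fderiv_eq_zero <| by
    by_contra hne
    exact hx (h.support (support_fderiv_subset ℝ hne))

theorem IsTest.mul_smooth {φ g : E d → ℝ} (h : IsTest O φ) (hg : ContDiff ℝ ∞ g) :
    IsTest O (fun x => φ x * g x) :=
  ⟨h.smooth.mul hg, h.compact.mul_right, (closure_mono fun x hx => by
    simp only [Function.mem_support] at hx ⊢
    exact left_ne_zero_of_mul hx).trans h.support⟩

theorem IsTest.add {φ ψ : E d → ℝ} (h : IsTest O φ) (h' : IsTest O ψ) :
    IsTest O (fun x => φ x + ψ x) :=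
  ⟨h.smooth.add h'.smooth, h.compact.add h'.compact,
    (tsupport_add φ ψ).trans (Set.union_subset h.support h'.support)⟩

theorem gradient_mul {φ g : E d → ℝ} {x : E d} (hφ : DifferentiableAt ℝ φ x)
    (hg : DifferentiableAt ℝ g x) :
    gradient (fun y => φ y * g y) x = φ x • gradient g x + g x • gradient φ x := by
  simp only [gradient]
  rw [fderiv_fun_mul hφ hg]
  simp

theorem gradient_add' {φ g : E d → ℝ} {x : E d} (hφ : DifferentiableAt ℝ φ x)
    (hg : DifferentiableAt ℝ g x) :
    gradient (fun y => φ y + g y) x = gradient φ x + gradient g x := by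
  simp only [gradient]
  rw [fderiv_fun_add hφ hg]
  simp

/-- Testing in a fixed direction v makes both sides scalar L² pairings, which are continuous in u
and G. -/
theorem isWeakGradient_iff {u : E d → ℝ} {G : E d → E d} (hu : MemLp u 2 (volume.restrict O))
    (hG : MemLp G 2 (volume.restrict O)) :
    IsWeakGradient O u G ↔ ∀ φ : E d → ℝ, IsTest O φ → ∀ v : E d,
      ∫ x in O, u x * inner ℝ (gradient φ x) v = - ∫ x in O, φ x * inner ℝ (G x) v := by
  refine forall_congr' fun φ => forall_congr' fun hφ => ?_
  have i1 : Integrable (fun x => u x • gradient φ x) (volume.restrict O) :=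
    memLp_one_iff_integrable.1 (hφ.memLp_gradient.smul hu)
  have i2 : Integrable (fun x => φ x • G x) (volume.restrict O) :=
    memLp_one_iff_integrable.1 (hG.smul hφ.memLp)
  have key : ∀ v : E d, inner ℝ v (∫ x in O, u x • gradient φ x)
        = ∫ x in O, u x * inner ℝ (gradient φ x) v := fun v => by
    rw [← integral_inner i1]
    simp only [inner_smul_right, real_inner_comm v]
  have key2 : ∀ v : E d, inner ℝ v (∫ x in O, φ x • G x)
        = ∫ x in O, φ x * inner ℝ (G x) v := fun v => by
    rw [← integral_inner i2]
    simp only [inner_smul_right, real_inner_comm v]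
  constructor
  · intro h v
    rw [← key, ← key2, h, inner_neg_right]
  · intro h
    refine ext_inner_left ℝ fun v => ?_
    rw [inner_neg_right, key, key2, h v]

theorem integral_mul_gradient_eq_neg {u φ : E d → ℝ} (hu : ContDiff ℝ ∞ u) (hφ : IsTest O φ)
    (v : E d) :
    ∫ x in O, u x * inner ℝ (gradient φ x) v = - ∫ x in O, φ x * inner ℝ (gradient u x) v := by
  rw [setIntegral_eq_integral_of_forall_compl_eq_zero
      (fun x hx => by simp [hφ.gradient_eq_zero hx]),
    setIntegral_eq_integral_of_forall_compl_eq_zero (fun x hx => by simp [hφ.eq_zero hx])]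
  simp only [inner_gradient_left]
  have hdu : Continuous fun x => fderiv ℝ u x v :=
    (hu.continuous_fderiv (by simp)).clm_apply continuous_const
  have hdφ : Continuous fun x => fderiv ℝ φ x v :=
    (hφ.smooth.continuous_fderiv (by simp)).clm_apply continuous_const
  have hcφ : HasCompactSupport fun x => fderiv ℝ φ x v :=
    (hφ.compact.fderiv (𝕜 := ℝ)).comp_left (g := fun L : E d →L[ℝ] ℝ => L v) (by simp)
  rw [integral_mul_fderiv_eq_neg_fderiv_mul_of_integrable (μ := (volume : Measure (E d)))
    (f := u) (g := φ) (v := v)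
    ((hdu.mul hφ.smooth.continuous).integrable_of_hasCompactSupport hφ.compact.mul_left)
    ((hu.continuous.mul hdφ).integrable_of_hasCompactSupport hcφ.mul_left)
    ((hu.continuous.mul hφ.smooth.continuous).integrable_of_hasCompactSupport hφ.compact.mul_left)
    (fun x _ => hu.differentiable (by simp) x) (fun x _ => hφ.differentiable x)]
  simp only [mul_comm]

/-! ### The Hilbert space `H¹` -/

theorem IsTest.memLp_smul_const {φ : E d → ℝ} (h : IsTest O φ) (v : E d) :
    MemLp (fun x => φ x • v) 2 (volume.restrict O) :=
  ((h.smooth.continuous.smul continuous_const).memLp_of_hasCompactSupport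
    h.compact.smul_right).restrict O

theorem IsTest.memLp_inner_gradient {φ : E d → ℝ} (h : IsTest O φ) (v : E d) :
    MemLp (fun x => (inner ℝ (gradient φ x) v : ℝ)) 2 (volume.restrict O) :=
  h.memLp_gradient.inner_const v

/-- The defining identities are equalities of continuous functionals, so they cut out a closed set.
Completeness of `H1 O` follows, as needed for Riesz and Lax–Milgram. -/
theorem isClosed_H1 : IsClosed (H1 O : Set (WithLp 2 (L2 O × L2v O))) := by
  have : (H1 O : Set (WithLp 2 (L2 O × L2v O))) = ⋂ φ : {φ : E d → ℝ // IsTest O φ}, ⋂ v : E d,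
      {p | (inner ℝ p.fst ((φ.2.memLp_inner_gradient v).toLp _) : ℝ)
        = - inner ℝ p.snd ((φ.2.memLp_smul_const v).toLp _)} := by
    ext p
    simp only [Set.mem_iInter, Set.mem_ofPred_eq, Subtype.forall]
    refine (isWeakGradient_iff (Lp.memLp p.fst) (Lp.memLp p.snd)).trans ?_
    refine forall_congr' fun φ => forall_congr' fun hφ => forall_congr' fun v => ?_
    rw [inner_eq_integral (ae_eq_refl _) (MemLp.coeFn_toLp _),
      inner_eq_integral (ae_eq_refl _) (MemLp.coeFn_toLp _)]
    simp only [inner_smul_right, RCLike.inner_apply, conj_trivial, mul_comm (inner ℝ _ v)]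
  rw [this]
  refine isClosed_iInter fun φ => isClosed_iInter fun v => isClosed_eq ?_ ?_
  · exact (WithLp.prod_continuous_ofLp 2 _ _).fst.inner continuous_const
  · exact ((WithLp.prod_continuous_ofLp 2 _ _).snd.inner continuous_const).neg

instance : CompleteSpace (H1 O) := isClosed_H1.completeSpace_coe

theorem two_ne_top_fact : Fact ((2 : ENNReal) ≠ ⊤) := ⟨by simp⟩

attribute [local instance] two_ne_top_fact

instance : SecondCountableTopology (L2v O) := inferInstance

instance : SecondCountableTopology (WithLp 2 (L2 O × L2v O)) := inferInstance

/-- The function of an element of `H¹(O)`, as a continuous linear map. -/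
def fnL : H1 O →L[ℝ] L2 O :=
  (WithLp.fstL 2 ℝ (L2 O) (L2v O)).comp (H1 O).subtypeL

/-- The weak gradient of an element of `H¹(O)`, as a continuous linear map. -/
def wgradL : H1 O →L[ℝ] L2v O :=
  (WithLp.sndL 2 ℝ (L2 O) (L2v O)).comp (H1 O).subtypeL

@[simp] theorem fnL_apply (u : H1 O) : fnL u = fn u := rfl

@[simp] theorem wgradL_apply (u : H1 O) : wgradL u = wgrad u := rfl

theorem H1.norm_sq (u : H1 O) : ‖u‖ ^ 2 = ‖fn u‖ ^ 2 + ‖wgrad u‖ ^ 2 :=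
  WithLp.prod_norm_sq_eq_of_L2 u.1

theorem H1.ext {u v : H1 O} (h : fn u = fn v) (h' : wgrad u = wgrad v) : u = v :=
  Subtype.ext ((WithLp.equiv 2 _).injective (Prod.ext h h'))

theorem H1.norm_wgrad_le (u : H1 O) : ‖wgrad u‖ ≤ ‖u‖ :=
  le_of_sq_le_sq (by linarith [H1.norm_sq u, sq_nonneg ‖fn u‖]) (norm_nonneg _)

theorem H1.norm_fn_le (u : H1 O) : ‖fn u‖ ≤ ‖u‖ :=
  le_of_sq_le_sq (by linarith [H1.norm_sq u, sq_nonneg ‖wgrad u‖]) (norm_nonneg _)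

/-- The element of `H¹(O)` given by an `L²` function and its weak gradient. -/
def H1.mk {u : E d → ℝ} {G : E d → E d} (hu : MemLp u 2 (volume.restrict O))
    (hG : MemLp G 2 (volume.restrict O)) (h : IsWeakGradient O u G) : H1 O :=
  ⟨WithLp.toLp 2 (hu.toLp u, hG.toLp G), by
    refine (isWeakGradient_iff (Lp.memLp _) (Lp.memLp _)).2 fun φ hφ v => ?_
    refine Eq.trans ?_ (((isWeakGradient_iff hu hG).1 h φ hφ v).trans ?_)
    · refine integral_congr_ae ?_
      filter_upwards [hu.coeFn_toLp] with x hx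
      exact congrArg (· * inner ℝ (gradient φ x) v) hx
    · refine congrArg Neg.neg (integral_congr_ae ?_)
      filter_upwards [hG.coeFn_toLp] with x hx
      exact congrArg (φ x * inner ℝ · v) hx.symm⟩

theorem H1.fn_mk {u : E d → ℝ} {G : E d → E d} (hu : MemLp u 2 (volume.restrict O))
    (hG : MemLp G 2 (volume.restrict O)) (h : IsWeakGradient O u G) :
    fn (H1.mk hu hG h) =ᵐ[volume.restrict O] u := hu.coeFn_toLp

theorem H1.wgrad_mk {u : E d → ℝ} {G : E d → E d} (hu : MemLp u 2 (volume.restrict O))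
    (hG : MemLp G 2 (volume.restrict O)) (h : IsWeakGradient O u G) :
    wgrad (H1.mk hu hG h) =ᵐ[volume.restrict O] G := hG.coeFn_toLp

theorem isWeakGradient_wgrad (u : H1 O) : IsWeakGradient O (fn u) (wgrad u) := u.2

theorem IsTest.isWeakGradient {φ : E d → ℝ} (h : IsTest O φ) :
    IsWeakGradient O φ (gradient φ) :=
  (isWeakGradient_iff h.memLp h.memLp_gradient).2 fun _ hψ v =>
    integral_mul_gradient_eq_neg h.smooth hψ v

/-- The class of a test function in `H¹(O)`. -/
def IsTest.toH1 {φ : E d → ℝ} (h : IsTest O φ) : H1 O :=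
  H1.mk h.memLp h.memLp_gradient h.isWeakGradient

theorem IsTest.fn_toH1 {φ : E d → ℝ} (h : IsTest O φ) : fn h.toH1 =ᵐ[volume.restrict O] φ :=
  H1.fn_mk _ _ _

theorem IsTest.wgrad_toH1 {φ : E d → ℝ} (h : IsTest O φ) :
    wgrad h.toH1 =ᵐ[volume.restrict O] gradient φ :=
  H1.wgrad_mk _ _ _

theorem mem_testFunctions_iff {u : H1 O} :
    u ∈ testFunctions O ↔ ∃ (φ : E d → ℝ) (h : IsTest O φ), u = h.toH1 := by
  constructor
  · rintro ⟨φ, h, h1, h2⟩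
    exact ⟨φ, h, H1.ext (Lp.ext (h1.trans h.fn_toH1.symm)) (Lp.ext (h2.trans h.wgrad_toH1.symm))⟩
  · rintro ⟨φ, h, rfl⟩
    exact ⟨φ, h, h.fn_toH1, h.wgrad_toH1⟩

theorem isTest_zero : IsTest O (fun _ => 0) :=
  ⟨contDiff_const, HasCompactSupport.zero, by simp [tsupport]⟩

theorem gradient_const_mul {φ : E d → ℝ} (c : ℝ) {x : E d} (hφ : DifferentiableAt ℝ φ x) :
    gradient (fun y => φ y * c) x = c • gradient φ x := by
  simp only [gradient]
  rw [fderiv_mul_const hφ]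
  simp

/-- The subspace of `H¹(O)` of the classes of test functions. -/
def testSubmodule (O : Set (E d)) : Submodule ℝ (H1 O) where
  carrier := testFunctions O
  zero_mem' := by
    refine ⟨_, isTest_zero, ?_, ?_⟩
    · exact Lp.coeFn_zero _ _ _
    · refine (Lp.coeFn_zero (E d) 2 _).trans (Eventually.of_forall fun x => ?_)
      exact (gradient_eq_zero_of_fderiv_eq_zero (by simp)).symm
  add_mem' := by
    rintro u v ⟨φ, hφ, h1, h2⟩ ⟨ψ, hψ, h3, h4⟩
    refine ⟨_, hφ.add hψ, ?_, ?_⟩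
    · refine (Lp.coeFn_add (fn u) (fn v)).trans ?_
      filter_upwards [h1, h3] with x hx hx'
      simp [hx, hx']
    · refine (Lp.coeFn_add (wgrad u) (wgrad v)).trans ?_
      filter_upwards [h2, h4] with x hx hx'
      rw [gradient_add' (hφ.differentiable x) (hψ.differentiable x), Pi.add_apply, hx, hx']
  smul_mem' := by
    rintro c u ⟨φ, hφ, h1, h2⟩
    refine ⟨_, hφ.mul_smooth (contDiff_const (c := c)), ?_, ?_⟩
    · refine (Lp.coeFn_smul c (fn u)).trans ?_
      filter_upwards [h1] with x hx
      simp [hx, mul_comm]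
    · refine (Lp.coeFn_smul c (wgrad u)).trans ?_
      filter_upwards [h2] with x hx
      rw [gradient_const_mul c (hφ.differentiable x), Pi.smul_apply, hx]

/-- `H¹₀(O)` as a closed subspace of `H¹(O)`. -/
def H10Submodule (O : Set (E d)) : Submodule ℝ (H1 O) := (testSubmodule O).topologicalClosure

theorem IsTest.toH1_mem {φ : E d → ℝ} (h : IsTest O φ) : h.toH1 ∈ H10Submodule O :=
  subset_closure (mem_testFunctions_iff.2 ⟨φ, h, rfl⟩)

/-! ### Products with test functions -/

theorem exists_smul_clm {F : Type*} [NormedAddCommGroup F] [NormedSpace ℝ F] {χ : E d → ℝ}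
    (hc : Continuous χ) (hs : HasCompactSupport χ) :
    ∃ T : Lp F 2 (volume.restrict O) →L[ℝ] Lp F 2 (volume.restrict O),
      ∀ f, T f =ᵐ[volume.restrict O] fun x => χ x • f x := by
  obtain ⟨C, hC⟩ := hc.bounded_above_of_compact_support hs
  obtain ⟨T, hT, -⟩ := exists_pointwise_clm (μ := volume.restrict O)
    (fun x => (χ x) • (LinearMap.id : F →ₗ[ℝ] F)) C
    (fun f hf => hc.aestronglyMeasurable.smul hf) (Eventually.of_forall fun x ξ => by
      rw [LinearMap.smul_apply, LinearMap.id_apply, norm_smul]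
      exact mul_le_mul_of_nonneg_right (hC x) (norm_nonneg _))
  exact ⟨T, hT⟩

theorem exists_smul_gradient_clm {χ : E d → ℝ} (h : IsTest O χ) :
    ∃ T : L2 O →L[ℝ] L2v O, ∀ f, T f =ᵐ[volume.restrict O] fun x => f x • gradient χ x := by
  obtain ⟨C, hC⟩ := h.continuous_gradient.bounded_above_of_compact_support
    h.hasCompactSupport_gradient
  obtain ⟨T, hT, -⟩ := exists_pointwise_clm (μ := volume.restrict O)
    (fun x => LinearMap.toSpanSingleton ℝ (E d) (gradient χ x)) C
    (fun f hf => hf.smul h.continuous_gradient.aestronglyMeasurable)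
    (Eventually.of_forall fun x ξ => by
      rw [LinearMap.toSpanSingleton_apply, norm_smul, mul_comm]
      exact mul_le_mul_of_nonneg_right (hC x) (norm_nonneg _))
  exact ⟨T, hT⟩

/-- Product rule for χu, from testing the weak gradient of u with χψ. Since χ has compact support in
O, ψ may be any smooth function; hence χu extended by zero has a weak gradient on the whole space.
-/
theorem IsWeakGradient.test_mul {χ u : E d → ℝ} {G : E d → E d} (hχ : IsTest O χ)
    (hu : MemLp u 2 (volume.restrict O)) (hG : MemLp G 2 (volume.restrict O))
    (h : IsWeakGradient O u G) {ψ : E d → ℝ} (hψ : ContDiff ℝ ∞ ψ) (v : E d) :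
    ∫ x in O, χ x * u x * inner ℝ (gradient ψ x) v
      = - ∫ x in O, ψ x * inner ℝ (χ x • G x + u x • gradient χ x) v := by
  have ht := hχ.mul_smooth hψ
  have h1 := (isWeakGradient_iff hu hG).1 h _ ht v
  have hcg : Continuous (gradient ψ) := (InnerProductSpace.toDual ℝ (E d)).symm.continuous.comp
    (hψ.continuous_fderiv (by simp))
  have m1 : MemLp (fun x => ψ x * inner ℝ (gradient χ x) v) 2 (volume.restrict O) :=
    (((hψ.continuous.mul (hχ.continuous_gradient.inner continuous_const))
      ).memLp_of_hasCompactSupport ((hχ.hasCompactSupport_gradient.comp_left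
        (g := fun w => (inner ℝ w v : ℝ)) (by simp)).mul_left)).restrict O
  have m2 : MemLp (fun x => χ x * inner ℝ (gradient ψ x) v) 2 (volume.restrict O) :=
    ((hχ.smooth.continuous.mul (hcg.inner continuous_const)).memLp_of_hasCompactSupport
      hχ.compact.mul_right).restrict O
  have i1 : Integrable (fun x => u x * (ψ x * inner ℝ (gradient χ x) v)) (volume.restrict O) :=
    hu.integrable_mul m1
  have i2 : Integrable (fun x => u x * (χ x * inner ℝ (gradient ψ x) v)) (volume.restrict O) :=
    hu.integrable_mul m2
  have i3 : Integrable (fun x => χ x * ψ x * inner ℝ (G x) v) (volume.restrict O) :=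
    ht.memLp.integrable_mul (hG.inner_const v)
  have e1 : ∀ x, u x * inner ℝ (gradient (fun y => χ y * ψ y) x) v
      = u x * (χ x * inner ℝ (gradient ψ x) v) + u x * (ψ x * inner ℝ (gradient χ x) v) := by
    intro x
    rw [gradient_mul (hχ.differentiable x) (hψ.differentiable (by simp) x), inner_add_left,
      real_inner_smul_left, real_inner_smul_left]
    ring
  simp only [e1] at h1
  rw [integral_add i2 i1] at h1
  have e2 : ∀ x, ψ x * inner ℝ (χ x • G x + u x • gradient χ x) v
      = χ x * ψ x * inner ℝ (G x) v + u x * (ψ x * inner ℝ (gradient χ x) v) := by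
    intro x
    rw [inner_add_left, real_inner_smul_left, real_inner_smul_left]
    ring
  simp only [e2]
  rw [integral_add i3 i1]
  have e3 : ∀ x, χ x * u x * inner ℝ (gradient ψ x) v
      = u x * (χ x * inner ℝ (gradient ψ x) v) := fun x => by ring
  simp only [e3]
  linarith

theorem exists_mul_clm {χ : E d → ℝ} (hχ : IsTest O χ) :
    ∃ M : H1 O →L[ℝ] H1 O, ∀ u : H1 O,
      fn (M u) =ᵐ[volume.restrict O] (fun x => χ x * fn u x) ∧
      wgrad (M u) =ᵐ[volume.restrict O] (fun x => χ x • wgrad u x + fn u x • gradient χ x) := by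
  obtain ⟨T, hT⟩ := exists_smul_clm (O := O) (F := ℝ) hχ.smooth.continuous hχ.compact
  obtain ⟨S, hS⟩ := exists_smul_clm (O := O) (F := E d) hχ.smooth.continuous hχ.compact
  obtain ⟨R, hR⟩ := exists_smul_gradient_clm hχ
  have hw : ∀ u : H1 O, ((S (wgrad u) + R (fn u) : L2v O)) =ᵐ[volume.restrict O]
      (fun x => χ x • wgrad u x + fn u x • gradient χ x) := by
    intro u
    filter_upwards [Lp.coeFn_add (S (wgrad u)) (R (fn u)), hS (wgrad u), hR (fn u)] with x h1 h2 h3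
    rw [h1, Pi.add_apply, h2, h3]
  let M₀ : H1 O →L[ℝ] WithLp 2 (L2 O × L2v O) :=
    (WithLp.prodContinuousLinearEquiv 2 ℝ (L2 O) (L2v O)).symm.toContinuousLinearMap.comp
      ((T.comp fnL).prod (S.comp wgradL + R.comp fnL))
  have hM₀ : ∀ u, M₀ u ∈ H1 O := by
    intro u
    refine (isWeakGradient_iff (Lp.memLp _) (Lp.memLp _)).2 fun ψ hψ v => ?_
    refine Eq.trans ?_ ((IsWeakGradient.test_mul hχ (Lp.memLp _) (Lp.memLp _) (isWeakGradient_wgrad u)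
      hψ.smooth v).trans ?_)
    · refine integral_congr_ae ?_
      filter_upwards [hT (fn u)] with x hx
      exact congrArg (· * inner ℝ (gradient ψ x) v) hx
    · refine congrArg Neg.neg (integral_congr_ae ?_)
      filter_upwards [hw u] with x hx
      exact congrArg (ψ x * inner ℝ · v) hx.symm
  exact ⟨M₀.codRestrict _ hM₀, fun u => ⟨hT (fn u), hw u⟩⟩

variable {F : Type*} [NormedAddCommGroup F] [NormedSpace ℝ F]

/-! ### Translations and mollification in `L²` -/

theorem eLpNorm_two_sq {α F : Type*} [NormedAddCommGroup F] [MeasurableSpace α] {μ : Measure α} (f : α → F) :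
    eLpNorm f 2 μ ^ 2 = ∫⁻ x, ‖f x‖ₑ ^ 2 ∂μ := by
  have := eLpNorm_nnreal_pow_eq_lintegral (f := f) (μ := μ) (p := 2) (by norm_num)
  simpa using this

theorem eLpNorm_two_le_of_sq_le {α F : Type*} [NormedAddCommGroup F] [MeasurableSpace α] {μ : Measure α} {f : α → F}
    {c : ENNReal} (h : ∫⁻ x, ‖f x‖ₑ ^ 2 ∂μ ≤ c ^ 2) : eLpNorm f 2 μ ≤ c := by
  rw [← eLpNorm_two_sq] at h
  exact (ENNReal.pow_le_pow_left_iff two_ne_zero).1 h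

theorem enorm_integral_sq_le {α : Type*} [MeasurableSpace α] {ν : Measure α}
    [IsProbabilityMeasure ν] {g : α → F} (hg : AEStronglyMeasurable g ν) :
    ‖∫ x, g x ∂ν‖ₑ ^ 2 ≤ ∫⁻ x, ‖g x‖ₑ ^ 2 ∂ν := by
  rw [← eLpNorm_two_sq]
  gcongr
  refine (enorm_integral_le_lintegral_enorm g).trans ?_
  rw [← eLpNorm_one_eq_lintegral_enorm]
  exact eLpNorm_le_eLpNorm_of_exponent_le (by norm_num) hg

/-- Write the difference as the integral of the derivative along the segment, apply Jensen and
Tonelli, and use translation invariance. Both Poincaré and Rellich rest on this bound. -/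
theorem eLpNorm_translate_sub_le {φ : E d → ℝ} (h : IsTest O φ) (t : E d) :
    eLpNorm (fun x => φ (x + t) - φ x) 2 volume ≤ ‖t‖ₑ * eLpNorm (gradient φ) 2 volume := by
  refine eLpNorm_two_le_of_sq_le ?_
  have hcd : Continuous (fderiv ℝ φ) := h.smooth.continuous_fderiv (by simp)
  have h1 : ∀ x, φ (x + t) - φ x
      = ∫ s, fderiv ℝ φ (x + s • t) t ∂(volume.restrict (Set.Ioc (0 : ℝ) 1)) := by
    intro x
    rw [← intervalIntegral.integral_of_le zero_le_one,
      intervalIntegral.integral_eq_sub_of_hasDerivAt (f := fun s : ℝ => φ (x + s • t))]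
    · simp
    · intro s _
      have e : HasDerivAt (fun s : ℝ => x + s • t) t s := by
        simpa using ((hasDerivAt_id s).smul_const t).const_add x
      exact ((h.differentiable _).hasFDerivAt).comp_hasDerivAt s e
    · exact Continuous.intervalIntegrable (by fun_prop) _ _
  have : IsProbabilityMeasure (volume.restrict (Set.Ioc (0 : ℝ) 1)) := ⟨by simp⟩
  calc ∫⁻ x, ‖φ (x + t) - φ x‖ₑ ^ 2
      ≤ ∫⁻ x, ∫⁻ s in Set.Ioc (0 : ℝ) 1, ‖fderiv ℝ φ (x + s • t) t‖ₑ ^ 2 := by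
        refine lintegral_mono fun x => ?_
        rw [h1]
        exact enorm_integral_sq_le (Continuous.aestronglyMeasurable (by fun_prop))
    _ = ∫⁻ s in Set.Ioc (0 : ℝ) 1, ∫⁻ x, ‖fderiv ℝ φ (x + s • t) t‖ₑ ^ 2 := by
        refine lintegral_lintegral_swap (Measurable.aemeasurable ?_)
        refine Continuous.measurable ?_
        unfold Function.uncurry
        fun_prop
    _ = ∫⁻ s in Set.Ioc (0 : ℝ) 1, ∫⁻ x, ‖fderiv ℝ φ x t‖ₑ ^ 2 := by
        refine lintegral_congr fun s => ?_
        exact lintegral_add_right_eq_self (fun x => ‖fderiv ℝ φ x t‖ₑ ^ 2) (s • t)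
    _ = ∫⁻ x, ‖fderiv ℝ φ x t‖ₑ ^ 2 := by simp
    _ ≤ ∫⁻ x, ‖t‖ₑ ^ 2 * ‖gradient φ x‖ₑ ^ 2 := by
        refine lintegral_mono fun x => ?_
        rw [← mul_pow]
        gcongr
        rw [← inner_gradient_left, ← enorm_norm t, ← enorm_norm (gradient φ x), ← enorm_mul]
        refine enorm_le_iff_norm_le.2 ?_
        rw [mul_comm]
        simpa using norm_inner_le_norm (𝕜 := ℝ) (gradient φ x) t
    _ = (‖t‖ₑ * eLpNorm (gradient φ) 2 volume) ^ 2 := by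
        rw [lintegral_const_mul' _ _ (by simp), mul_pow, eLpNorm_two_sq]

open scoped Convolution in
/-- The mollification of `G` by the normalised bump function `ρ`. -/
def mollify (ρ : ContDiffBump (0 : E d)) (G : E d → F) : E d → F :=
  ρ.normed volume ⋆[ContinuousLinearMap.lsmul ℝ ℝ, volume] G

/-- The mollification error is the average of G(x − t) − G(x) over t, for the probability measure
with density the normalised bump. Jensen and Tonelli bound it by the worst translation error on the
support of the bump. -/
theorem eLpNorm_mollify_sub_le [CompleteSpace F] (ρ : ContDiffBump (0 : E d)) {G : E d → F}
    (hG : StronglyMeasurable G) (hi : LocallyIntegrable G volume) {c : ENNReal}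
    (hc : ∀ t ∈ Metric.closedBall (0 : E d) ρ.rOut,
      eLpNorm (fun x => G (x + t) - G x) 2 volume ≤ c) :
    eLpNorm (fun x => mollify ρ G x - G x) 2 volume ≤ c := by
  refine eLpNorm_two_le_of_sq_le ?_
  set r : E d → ENNReal := fun t => ENNReal.ofReal (ρ.normed volume t) with hr
  have hrm : Measurable r := ρ.continuous_normed.measurable.ennreal_ofReal
  set ν : Measure (E d) := volume.withDensity r with hν
  have hprob : IsProbabilityMeasure ν := ⟨by
    rw [hν, withDensity_apply _ MeasurableSet.univ, Measure.restrict_univ,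
      ← ofReal_integral_eq_lintegral_ofReal ρ.integrable_normed
        (Eventually.of_forall ρ.nonneg_normed), ρ.integral_normed, ENNReal.ofReal_one]⟩
  have htop : ∀ᵐ x ∂(volume : Measure (E d)), r x < ⊤ := Eventually.of_forall fun x => by simp [hr]
  have hsm : ∀ t, (r t).toReal = ρ.normed volume t := fun t =>
    ENNReal.toReal_ofReal (ρ.nonneg_normed t)
  have h1 : ∀ x, mollify ρ G x - G x = ∫ t, (G (x - t) - G x) ∂ν := by
    intro x
    have hint : Integrable (fun t => G (x - t)) ν := by
      rw [hν, integrable_withDensity_iff_integrable_smul' hrm htop]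
      simp only [hsm]
      exact (ρ.hasCompactSupport_normed (μ := volume)).convolutionExists_left
        (ContinuousLinearMap.lsmul ℝ ℝ) ρ.continuous_normed hi x
    rw [integral_sub hint (integrable_const _), integral_const, probReal_univ, one_smul]
    congr 1
    rw [hν, integral_withDensity_eq_integral_toReal_smul hrm htop]
    simp only [hsm]
    rfl
  have hmeas : StronglyMeasurable (Function.uncurry fun x t : E d => G (x - t) - G x) :=
    (hG.comp_measurable (measurable_fst.sub measurable_snd)).sub
      (hG.comp_measurable measurable_fst)
  calc ∫⁻ x, ‖mollify ρ G x - G x‖ₑ ^ 2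
      ≤ ∫⁻ x, ∫⁻ t, ‖G (x - t) - G x‖ₑ ^ 2 ∂ν := by
        refine lintegral_mono fun x => ?_
        rw [h1]
        exact enorm_integral_sq_le
          (hmeas.comp_measurable measurable_prodMk_left).aestronglyMeasurable
    _ = ∫⁻ t, (∫⁻ x, ‖G (x - t) - G x‖ₑ ^ 2) ∂ν := by
        exact lintegral_lintegral_swap (hmeas.enorm.pow_const 2).aemeasurable
    _ ≤ ∫⁻ t, c ^ 2 ∂ν := by
        refine lintegral_mono_ae ?_
        rw [hν, ae_withDensity_iff hrm]
        refine Eventually.of_forall fun t ht => ?_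
        have ht' : t ∈ Metric.ball (0 : E d) ρ.rOut := by
          rw [← ρ.support_normed_eq (μ := volume)]
          intro h0
          exact ht (by simp [hr, h0])
        have := hc (-t) (by simpa using (Metric.ball_subset_closedBall ht'))
        rw [← eLpNorm_two_sq]
        gcongr
        simpa [sub_eq_add_neg] using this
    _ = c ^ 2 := by simp

theorem exists_eLpNorm_translate_sub_le {F : Type*} [NormedAddCommGroup F] {G : E d → F} (hG : MemLp G 2 volume) {η : ENNReal}
    (hη : 0 < η) :
    ∃ δ > 0, ∀ t ∈ Metric.closedBall (0 : E d) δ,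
      eLpNorm (fun x => G (x + t) - G x) 2 volume ≤ η := by
  have : Fact ((2 : ENNReal) ≠ ⊤) := ⟨by simp⟩
  -- Translations act continuously on L² by Mathlib's domain action; continuity at t = 0 is the
  -- claim.
  have hc : Continuous fun t : E d => DomAddAct.mk t +ᵥ hG.toLp G :=
    DomAddAct.continuous_mk.vadd continuous_const
  have h0 := hc.tendsto 0
  rw [EMetric.tendsto_nhds] at h0
  obtain ⟨δ, hδ, hball⟩ := Metric.eventually_nhds_iff_ball.1 (h0 η hη)
  refine ⟨δ / 2, by positivity, fun t ht => ?_⟩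
  have h1 := hball t (Metric.closedBall_subset_ball (by linarith) ht)
  rw [DomAddAct.mk_vadd_toLp, DomAddAct.mk_vadd_toLp, Lp.edist_toLp_toLp] at h1
  refine le_trans (le_of_eq ?_) h1.le
  congr 1
  ext x
  simp [add_comm]

/-! ### The Poincaré inequality -/

theorem IsTest.eLpNorm_eq {φ : E d → ℝ} (h : IsTest O φ) :
    eLpNorm φ 2 volume = ‖fn h.toH1‖ₑ := by
  rw [← eLpNorm_restrict_eq_of_support_subset (s := O) (fun x hx => by_contra fun hx' =>
    hx (h.eq_zero hx')), Lp.enorm_def]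
  exact eLpNorm_congr_ae h.fn_toH1.symm

theorem IsTest.eLpNorm_gradient_eq {φ : E d → ℝ} (h : IsTest O φ) :
    eLpNorm (gradient φ) 2 volume = ‖wgrad h.toH1‖ₑ := by
  rw [← eLpNorm_restrict_eq_of_support_subset (s := O) (fun x hx => by_contra fun hx' =>
    hx (h.gradient_eq_zero hx')), Lp.enorm_def]
  exact eLpNorm_congr_ae h.wgrad_toH1.symm

/-- A translation longer than the diameter of O moves O off itself, so |φ(x)| ≤ |φ(x + t) − φ(x)|
for all x, and the translation estimate gives the constant ‖t‖. Density then covers `H10 O`. -/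
theorem exists_poincare (hd : 1 ≤ d) (hOb : Bornology.IsBounded O) :
    ∃ C : ℝ, 0 ≤ C ∧ ∀ u ∈ H10 O, ‖fn u‖ ≤ C * ‖wgrad u‖ := by
  obtain ⟨R, hR0, hR⟩ := hOb.exists_pos_norm_le
  have : Nonempty (Fin d) := ⟨⟨0, hd⟩⟩
  -- Points of O have norm at most R, so two of them differ by at most 2R. The condition d ≥ 1
  -- provides a vector of norm 2R + 1.
  obtain ⟨t, ht⟩ := exists_norm_eq (E d) (c := 2 * R + 1) (by positivity)
  refine ⟨‖t‖, norm_nonneg _, ?_⟩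
  refine closure_minimal ?_ (isClosed_le (fnL.continuous.norm)
    (continuous_const.mul wgradL.continuous.norm))
  intro u hu
  obtain ⟨φ, h, rfl⟩ := mem_testFunctions_iff.1 hu
  have h1 : eLpNorm φ 2 volume ≤ eLpNorm (fun x => φ (x + t) - φ x) 2 volume := by
    refine eLpNorm_mono fun x => ?_
    by_cases hx : φ x = 0
    · simp [hx]
    · have hxO : x ∈ O := by_contra fun hx' => hx (h.eq_zero hx')
      have hxt : x + t ∉ O := fun hx' => by
        have e1 := hR _ hx'
        have e2 := hR _ hxO
        have e3 := norm_sub_le (x + t) x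
        rw [add_sub_cancel_left] at e3
        linarith
      simp [h.eq_zero hxt]
  have h2 := h1.trans (eLpNorm_translate_sub_le h t)
  rw [h.eLpNorm_eq, h.eLpNorm_gradient_eq, ← enorm_norm, ← enorm_norm t,
    ← enorm_norm (wgrad _), ← enorm_mul, enorm_le_iff_norm_le] at h2
  change ‖fn h.toH1‖ ≤ ‖t‖ * ‖wgrad h.toH1‖
  simpa using h2

/-! ### Density of test functions among compactly supported `H¹` functions -/

theorem contDiff_mollify (ρ : ContDiffBump (0 : E d)) {v : E d → ℝ}
    (hv : LocallyIntegrable v volume) : ContDiff ℝ ∞ (mollify ρ v) :=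
  (ρ.hasCompactSupport_normed (μ := volume)).contDiff_convolution_left _ ρ.contDiff_normed hv

theorem isTest_mollify (ρ : ContDiffBump (0 : E d)) {v : E d → ℝ} {K : Set (E d)}
    (hv : LocallyIntegrable v volume) (hK : IsCompact K) (hvK : ∀ x ∉ K, v x = 0)
    (hKO : Metric.cthickening ρ.rOut K ⊆ O) : IsTest O (mollify ρ v) := by
  have h1 : tsupport (mollify ρ v) ⊆ Metric.cthickening ρ.rOut K := by
    refine closure_minimal ?_ Metric.isClosed_cthickening
    refine (support_convolution_subset_swap _).trans ?_
    rintro _ ⟨x, hx, y, hy, rfl⟩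
    rw [ρ.support_normed_eq, mem_ball_zero_iff] at hy
    refine Metric.mem_cthickening_of_dist_le _ x _ _ (by_contra fun hx' => hx (hvK x hx')) ?_
    simpa using hy.le
  exact ⟨contDiff_mollify ρ hv, (hK.cthickening).of_isClosed_subset (isClosed_tsupport _) h1,
    h1.trans hKO⟩

/-- Differentiate under the convolution on the kernel, then use t ↦ ρ(x − t) as the function ψ in
`h`; its inner derivative gives the sign that cancels the minus. -/
theorem gradient_mollify (ρ : ContDiffBump (0 : E d)) {v : E d → ℝ} {G : E d → E d}
    (hv : LocallyIntegrable v volume) (hG : LocallyIntegrable G volume)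
    (h : ∀ ψ : E d → ℝ, ContDiff ℝ ∞ ψ → ∀ w : E d,
      ∫ x, v x * inner ℝ (gradient ψ x) w = - ∫ x, ψ x * inner ℝ (G x) w) (x : E d) :
    gradient (mollify ρ v) x = mollify ρ G x := by
  refine ext_inner_right ℝ fun w => ?_
  rw [inner_gradient_left]
  have hcs := ρ.hasCompactSupport_normed (μ := (volume : Measure (E d)))
  have hρ : ContDiff ℝ ∞ (ρ.normed (volume : Measure (E d))) := ρ.contDiff_normed
  have h1 := hcs.hasFDerivAt_convolution_right (ContinuousLinearMap.lsmul ℝ ℝ).flip hv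
    (hρ.of_le (by simp)) x
  rw [convolution_flip] at h1
  have h2 : fderiv ℝ (mollify ρ v) x w
      = ∫ t, v t * fderiv ℝ (ρ.normed volume) (x - t) w := by
    rw [show fderiv ℝ (mollify ρ v) x = _ from h1.fderiv, convolution_precompR_apply _ hv (hcs.fderiv (𝕜 := ℝ))
      (hρ.continuous_fderiv (by simp))]
    simp [convolution, mul_comm]
  have hψ : ContDiff ℝ ∞ fun t => ρ.normed volume (x - t) := hρ.comp (contDiff_const.sub contDiff_id)
  have h3 := h _ hψ w
  have h4 : ∀ t, (inner ℝ (gradient (fun t => ρ.normed volume (x - t)) t) w : ℝ)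
      = - fderiv ℝ (ρ.normed volume) (x - t) w := by
    intro t
    have e : HasFDerivAt (fun t : E d => x - t) (-ContinuousLinearMap.id ℝ (E d)) t := by
      simpa using (hasFDerivAt_id t).const_sub x
    have e2 := ((hρ.differentiable (by simp) (x - t)).hasFDerivAt).comp t e
    rw [inner_gradient_left]
    have e3 : fderiv ℝ (fun t => ρ.normed volume (x - t)) t = _ := e2.fderiv
    rw [e3]
    simp
  simp only [h4, mul_neg, integral_neg, neg_inj] at h3
  rw [h2, h3]
  have hint : Integrable (fun t => ρ.normed volume (x - t) • G t) volume := by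
    have := (hcs.convolutionExists_left (ContinuousLinearMap.lsmul ℝ ℝ) ρ.continuous_normed hG
      x).integrable_swap
    simpa using this
  rw [mollify, convolution_eq_swap, real_inner_comm, ← integral_inner (𝕜 := ℝ) (by simpa using hint)]
  refine integral_congr_ae (Eventually.of_forall fun t => ?_)
  simp [inner_smul_right, real_inner_comm]

theorem H1.norm_le_add (u : H1 O) : ‖u‖ ≤ ‖fn u‖ + ‖wgrad u‖ := by
  refine le_of_sq_le_sq ?_ (by positivity)
  rw [H1.norm_sq]
  nlinarith [norm_nonneg (fn u), norm_nonneg (wgrad u)]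

theorem norm_sub_le_of_ae_eq {F : Type*} [NormedAddCommGroup F] {η : ℝ} (hη : 0 ≤ η)
    {f g : Lp F 2 (volume.restrict O)}
    {f' g' : E d → F} (hf : f =ᵐ[volume.restrict O] f') (hg : g =ᵐ[volume.restrict O] g')
    (h : eLpNorm (fun x => f' x - g' x) 2 volume ≤ ENNReal.ofReal η) : ‖f - g‖ ≤ η := by
  rw [← ENNReal.ofReal_le_ofReal_iff hη, ofReal_norm, Lp.enorm_def]
  refine le_trans (le_of_eq (eLpNorm_congr_ae ?_)) ((eLpNorm_restrict_le _ 2 volume O).trans h)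
  filter_upwards [Lp.coeFn_sub f g, hf, hg] with x h1 h2 h3
  rw [h1, Pi.sub_apply, h2, h3]

/-- The product χu vanishes outside the compact support of χ, at positive distance from the
complement of O. Mollifying it at a small scale therefore gives test functions on O, converging
together with their gradients. -/
theorem mem_H10_of_ae_eq_mul (hO : IsOpen O) {χ : E d → ℝ} (hχ : IsTest O χ) {u w : H1 O}
    (h1 : fn w =ᵐ[volume.restrict O] (fun x => χ x * fn u x))
    (h2 : wgrad w =ᵐ[volume.restrict O] (fun x => χ x • wgrad u x + fn u x • gradient χ x)) :
    w ∈ H10 O := by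
  set v : E d → ℝ := fun x => χ x * fn u x with hv
  set G : E d → E d := fun x => χ x • wgrad u x + fn u x • gradient χ x with hG
  have hvm : StronglyMeasurable v :=
    hχ.smooth.continuous.stronglyMeasurable.mul (Lp.stronglyMeasurable _)
  have hGm : StronglyMeasurable G :=
    (hχ.smooth.continuous.stronglyMeasurable.smul (Lp.stronglyMeasurable (wgrad u))).add
      ((Lp.stronglyMeasurable (fn u)).smul hχ.continuous_gradient.stronglyMeasurable)
  have hχK : ∀ x ∉ tsupport χ, χ x = 0 := fun x hx => image_eq_zero_of_notMem_tsupport hx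
  have hvK : ∀ x ∉ tsupport χ, v x = 0 := fun x hx => by simp [hv, hχK x hx]
  have hv0 : ∀ x ∉ O, v x = 0 := fun x hx => by simp [hv, hχ.eq_zero hx]
  have hG0 : ∀ x ∉ O, G x = 0 := fun x hx => by simp [hG, hχ.eq_zero hx, hχ.gradient_eq_zero hx]
  have hv2 : MemLp v 2 volume := by
    have := (memLp_indicator_iff_restrict hO.measurableSet).2 ((Lp.memLp (fn w)).ae_eq h1)
    rwa [Set.indicator_eq_self.2 fun x hx => by_contra fun hx' => hx (hv0 x hx')] at this
  have hG2 : MemLp G 2 volume := by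
    have := (memLp_indicator_iff_restrict hO.measurableSet).2 ((Lp.memLp (wgrad w)).ae_eq h2)
    rwa [Set.indicator_eq_self.2 fun x hx => by_contra fun hx' => hx (hG0 x hx')] at this
  have hvi := hv2.locallyIntegrable (by norm_num)
  have hGi := hG2.locallyIntegrable (by norm_num)
  have hweak : ∀ ψ : E d → ℝ, ContDiff ℝ ∞ ψ → ∀ z : E d,
      ∫ x, v x * inner ℝ (gradient ψ x) z = - ∫ x, ψ x * inner ℝ (G x) z := by
    intro ψ hψ z
    have := IsWeakGradient.test_mul hχ (Lp.memLp (fn u)) (Lp.memLp (wgrad u))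
      (isWeakGradient_wgrad u) hψ z
    rwa [setIntegral_eq_integral_of_forall_compl_eq_zero
        (fun x hx => by simp [hχ.eq_zero hx]),
      setIntegral_eq_integral_of_forall_compl_eq_zero
        (fun x hx => by simp [hχ.eq_zero hx, hχ.gradient_eq_zero hx])] at this
  obtain ⟨δ₀, hδ₀, hthick⟩ := hχ.compact.isCompact.exists_cthickening_subset_open hO hχ.support
  refine Metric.mem_closure_iff.2 fun η hη => ?_
  have hη' : (0 : ENNReal) < ENNReal.ofReal (η / 4) := by simpa using hη
  obtain ⟨δ₁, hδ₁, hv1⟩ := exists_eLpNorm_translate_sub_le hv2 hη'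
  obtain ⟨δ₂, hδ₂, hG1⟩ := exists_eLpNorm_translate_sub_le hG2 hη'
  -- δ₀ keeps the support inside O; δ₁ and δ₂ control the errors of the function and of its
  -- gradient.
  have hδ : 0 < min δ₀ (min δ₁ δ₂) := by positivity
  let ρ : ContDiffBump (0 : E d) :=
    ⟨min δ₀ (min δ₁ δ₂) / 2, min δ₀ (min δ₁ δ₂), by positivity, by linarith⟩
  have hρ : ρ.rOut = min δ₀ (min δ₁ δ₂) := rfl
  have ht : IsTest O (mollify ρ v) := isTest_mollify ρ hvi hχ.compact.isCompact hvK
    ((Metric.cthickening_mono (by rw [hρ]; exact min_le_left _ _) _).trans hthick)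
  refine ⟨ht.toH1, mem_testFunctions_iff.2 ⟨_, ht, rfl⟩, ?_⟩
  have hgr : gradient (mollify ρ v) = mollify ρ G := funext (gradient_mollify ρ hvi hGi hweak)
  have b1 := eLpNorm_mollify_sub_le ρ hvm hvi (fun t ht => hv1 t
    (Metric.closedBall_subset_closedBall (by rw [hρ]; simp) ht))
  have b2 := eLpNorm_mollify_sub_le ρ hGm hGi (fun t ht => hG1 t
    (Metric.closedBall_subset_closedBall (by rw [hρ]; simp) ht))
  have c1 : ‖fn ht.toH1 - fn w‖ ≤ η / 4 :=
    norm_sub_le_of_ae_eq (by positivity) ht.fn_toH1 h1 b1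
  have c2 : ‖wgrad ht.toH1 - wgrad w‖ ≤ η / 4 :=
    norm_sub_le_of_ae_eq (by positivity) (ht.wgrad_toH1.trans (by rw [hgr])) h2 b2
  rw [dist_comm, dist_eq_norm]
  have := H1.norm_le_add (ht.toH1 - w)
  rw [← fnL_apply, ← wgradL_apply, map_sub, map_sub, fnL_apply, fnL_apply, wgradL_apply,
    wgradL_apply] at this
  linarith

/-! ### Rellich's theorem -/

theorem memLp_normed (ρ : ContDiffBump (0 : E d)) : MemLp (ρ.normed volume) 2 volume :=
  ρ.continuous_normed.memLp_of_hasCompactSupport (ρ.hasCompactSupport_normed (μ := volume))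

theorem memLp_normed_sub (ρ : ContDiffBump (0 : E d)) (x : E d) :
    MemLp (fun y => ρ.normed volume (x - y)) 2 volume :=
  (memLp_normed ρ).comp_measurePreserving (Measure.measurePreserving_sub_left volume x)

theorem eLpNorm_normed_sub (ρ : ContDiffBump (0 : E d)) (x : E d) :
    eLpNorm (fun y => ρ.normed volume (x - y)) 2 volume = eLpNorm (ρ.normed volume) 2 volume :=
  eLpNorm_comp_measurePreserving (μ := volume) (ν := volume) (g := ρ.normed volume)
    (f := fun y => x - y) (memLp_normed ρ).1 (Measure.measurePreserving_sub_left volume x)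

/-- For fixed x the mollified value is a bounded functional of φ in L², so weak convergence becomes
pointwise convergence after mollification. -/
theorem mollify_eq_inner (ρ : ContDiffBump (0 : E d)) {φ : E d → ℝ} (h : IsTest O φ) (x : E d)
    (hx : MemLp (fun y => ρ.normed volume (x - y)) 2 (volume.restrict O)) :
    mollify ρ φ x = inner ℝ (fn h.toH1) (hx.toLp _) := by
  rw [inner_eq_integral h.fn_toH1 hx.coeFn_toLp, mollify, convolution_eq_swap,
    setIntegral_eq_integral_of_forall_compl_eq_zero (fun y hy => by simp [h.eq_zero hy])]
  rfl

/-- At a fixed scale the mollifications tend to 0 pointwise and are uniformly bounded, hence tend to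
0 in L²(O) by dominated convergence, O having finite measure. The mollification error is at most the
scale times the gradient bound, uniformly in n. -/
theorem tendsto_fn_of_isTest (hOb : Bornology.IsBounded O) {φ : ℕ → E d → ℝ}
    (h : ∀ n, IsTest O (φ n)) (hw : WeaklyTendsto (fun n => (h n).toH1) atTop 0) :
    Tendsto (fun n => fn (h n).toH1) atTop (𝓝 0) := by
  obtain ⟨C, hC⟩ := hw.exists_norm_le
  have hC0 : 0 ≤ C := (norm_nonneg _).trans (hC 0)
  have hfin : volume O ≠ ⊤ := hOb.measure_lt_top.ne
  have hwf : WeaklyTendsto (fun n => fn (h n).toH1) atTop 0 := by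
    simpa only [map_zero, fnL_apply] using hw.map fnL
  rw [tendsto_zero_iff_norm_tendsto_zero, Metric.tendsto_atTop']
  intro η hη
  -- This scale makes the mollification error at most η/2; the mollified part will take η/4, so the
  -- sum stays below η. The +1 covers C = 0.
  have hδ : 0 < η / (2 * (C + 1)) := by positivity
  obtain ⟨ρ, hρ⟩ : ∃ ρ : ContDiffBump (0 : E d), ρ.rOut = η / (2 * (C + 1)) :=
    ⟨⟨η / (2 * (C + 1)) / 2, η / (2 * (C + 1)), by positivity, by linarith⟩, rfl⟩
  have hk : ∀ x : E d, MemLp (fun y => ρ.normed volume (x - y)) 2 (volume.restrict O) :=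
    fun x => (memLp_normed_sub ρ x).restrict O
  have hkK : ∀ x, ‖(hk x).toLp _‖ₑ ≤ eLpNorm (ρ.normed (volume : Measure (E d))) 2 volume :=
    fun x => by
      rw [Lp.enorm_toLp]
      exact (eLpNorm_restrict_le _ _ _ _).trans (eLpNorm_normed_sub ρ x).le
  generalize hK : eLpNorm (ρ.normed (volume : Measure (E d))) 2 volume = K at hkK
  have hKt : K ≠ ⊤ := hK ▸ (memLp_normed ρ).2.ne
  have hlim : Tendsto (fun n => ∫⁻ x in O, ‖mollify ρ (φ n) x‖ₑ ^ 2) atTop (𝓝 0) := by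
    suffices Tendsto (fun n => ∫⁻ x in O, ‖mollify ρ (φ n) x‖ₑ ^ 2) atTop
        (𝓝 (∫⁻ _ in O, (0 : ENNReal))) by rwa [lintegral_zero] at this
    refine tendsto_lintegral_of_dominated_convergence (fun _ => (ENNReal.ofReal C * K) ^ 2)
      (fun n => ?_) (fun n => ?_) ?_ ?_
    · exact ((contDiff_mollify ρ ((h n).smooth.continuous.locallyIntegrable)
        ).continuous.measurable.enorm.pow_const 2)
    · refine Eventually.of_forall fun x => ?_
      dsimp only
      gcongr
      rw [mollify_eq_inner ρ (h n) x (hk x)]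
      refine le_trans (b := ‖fn (h n).toH1‖ₑ * ‖(hk x).toLp _‖ₑ) ?_ ?_
      · rw [← enorm_norm (fn _), ← enorm_norm ((hk x).toLp _), ← enorm_mul, enorm_le_iff_norm_le]
        simpa using norm_inner_le_norm (𝕜 := ℝ) (fn (h n).toH1) ((hk x).toLp _)
      · refine mul_le_mul' ?_ (hkK x)
        rw [← ofReal_norm]
        exact ENNReal.ofReal_le_ofReal ((H1.norm_fn_le _).trans (hC n))
    · rw [lintegral_const, Measure.restrict_apply_univ]
      exact ENNReal.mul_ne_top (ENNReal.pow_ne_top (ENNReal.mul_ne_top (by simp) hKt)) hfin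
    · refine Eventually.of_forall fun x => ?_
      have e := hwf ((hk x).toLp _)
      simp only [← mollify_eq_inner ρ (h _) x (hk x), inner_zero_left] at e
      have := ((ENNReal.continuous_pow 2).tendsto _).comp e.enorm
      simpa [Function.comp_def] using this
  have hpos : (0 : ENNReal) < ENNReal.ofReal (η / 4) ^ 2 := by
    have : (0 : ENNReal) < ENNReal.ofReal (η / 4) := by simpa using hη
    positivity
  obtain ⟨N, hN⟩ := eventually_atTop.1 (hlim.eventually_le_const hpos)
  refine ⟨N, fun n hn => ?_⟩
  have a1 : eLpNorm (mollify ρ (φ n)) 2 (volume.restrict O) ≤ ENNReal.ofReal (η / 4) :=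
    eLpNorm_two_le_of_sq_le (hN n hn.le)
  have a2 : eLpNorm (fun x => mollify ρ (φ n) x - φ n x) 2 volume ≤ ENNReal.ofReal (η / 2) := by
    refine eLpNorm_mollify_sub_le ρ (h n).smooth.continuous.stronglyMeasurable
      (h n).smooth.continuous.locallyIntegrable fun t ht => ?_
    refine (eLpNorm_translate_sub_le (h n) t).trans ?_
    rw [(h n).eLpNorm_gradient_eq, ← ofReal_norm, ← ofReal_norm,
      ← ENNReal.ofReal_mul (norm_nonneg _)]
    refine ENNReal.ofReal_le_ofReal ?_
    have ht' : ‖t‖ ≤ η / (2 * (C + 1)) := by simpa [hρ] using ht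
    calc ‖t‖ * ‖wgrad (h n).toH1‖ ≤ η / (2 * (C + 1)) * C :=
          mul_le_mul ht' ((H1.norm_wgrad_le _).trans (hC n)) (norm_nonneg _) hδ.le
      _ ≤ η / (2 * (C + 1)) * (C + 1) := by gcongr; linarith
      _ = η / 2 := by field_simp
  have hm : AEStronglyMeasurable (mollify ρ (φ n)) (volume.restrict O) :=
    (contDiff_mollify ρ ((h n).smooth.continuous.locallyIntegrable)
      ).continuous.aestronglyMeasurable
  have a3 : ‖fn (h n).toH1‖ₑ ≤ ENNReal.ofReal (η / 4) + ENNReal.ofReal (η / 2) := by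
    rw [Lp.enorm_def, eLpNorm_congr_ae (h n).fn_toH1]
    have e : φ n = mollify ρ (φ n) - fun x => mollify ρ (φ n) x - φ n x := by
      ext x; simp
    rw [e]
    refine (eLpNorm_sub_le hm (hm.sub (h n).smooth.continuous.aestronglyMeasurable)
      (by norm_num)).trans (add_le_add a1 ?_)
    exact (eLpNorm_restrict_le _ _ _ _).trans a2
  rw [← ENNReal.ofReal_add (by positivity) (by positivity), ← ofReal_norm,
    ENNReal.ofReal_le_ofReal_iff (by positivity)] at a3
  rw [dist_zero_right, norm_norm]
  linarith

/-- Replace u n − u₀ by a test function within 1/(n+1) in H¹. The replacement error tends to 0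
strongly, so the test functions still converge weakly to 0. -/
theorem tendsto_fn_of_mem_H10 (hOb : Bornology.IsBounded O) {u : ℕ → H1 O} {u₀ : H1 O}
    (hu : ∀ n, u n ∈ H10 O) (hu₀ : u₀ ∈ H10 O) (h : WeaklyTendsto u atTop u₀) :
    Tendsto (fun n => fn (u n)) atTop (𝓝 (fn u₀)) := by
  have hs : ∀ n, u n - u₀ ∈ closure (testFunctions O) := fun n =>
    (H10Submodule O).sub_mem (hu n) hu₀
  have hex : ∀ n : ℕ, ∃ (φ : E d → ℝ) (h : IsTest O φ), ‖u n - u₀ - h.toH1‖ < 1 / ((n : ℝ) + 1) := by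
    intro n
    obtain ⟨v, hv, hvu⟩ := Metric.mem_closure_iff.1 (hs n) (1 / ((n : ℝ) + 1)) (by positivity)
    obtain ⟨φ, hφ, rfl⟩ := mem_testFunctions_iff.1 hv
    exact ⟨φ, hφ, by rwa [dist_eq_norm] at hvu⟩
  choose φ hφ hn using hex
  have hz : Tendsto (fun n => u n - u₀ - (hφ n).toH1) atTop (𝓝 0) :=
    squeeze_zero_norm (fun n => (hn n).le) tendsto_one_div_add_atTop_nhds_zero_nat
  have hw : WeaklyTendsto (fun n => (hφ n).toH1) atTop 0 := by
    have := (h.sub (weaklyTendsto_of_tendsto tendsto_const_nhds (x₀ := u₀))).sub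
      (weaklyTendsto_of_tendsto hz)
    simpa using this
  have h1 := tendsto_fn_of_isTest hOb hφ hw
  have h2 := (fnL.continuous.tendsto _).comp hz
  have h3 := (h1.add h2).add (tendsto_const_nhds (x := fn u₀))
  simp only [map_zero, add_zero, zero_add] at h3
  refine h3.congr fun n => ?_
  simp only [Function.comp_apply, map_sub, fnL_apply]
  abel

/-! ### The Dirichlet problem -/

theorem forall_mem_H10_of_isTest {A : H1 O → ℝ} {B : H1 O → ℝ} (hA : Continuous A)
    (hB : Continuous B) (h : ∀ (φ : E d → ℝ) (hφ : IsTest O φ), A hφ.toH1 = B hφ.toH1) :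
    ∀ v ∈ H10 O, A v = B v := by
  intro v hv
  have hcl : IsClosed {v | A v = B v} := isClosed_eq hA hB
  refine closure_minimal ?_ hcl hv
  intro u hu
  obtain ⟨φ, hφ, rfl⟩ := mem_testFunctions_iff.1 hu
  exact h φ hφ

/-- The right-hand side `f - ∇·F` as a functional on `H¹(O)`. -/
def loadL (f : L2 O) (F : L2v O) : H1 O →L[ℝ] ℝ :=
  (innerSL ℝ f).comp fnL + (innerSL ℝ F).comp wgradL

theorem loadL_apply (f : L2 O) (F : L2v O) (v : H1 O) :
    loadL f F v = inner ℝ f (fn v) + inner ℝ F (wgrad v) := rfl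

theorem abs_loadL_le (f : L2 O) (F : L2v O) (v : H1 O) :
    |loadL f F v| ≤ (‖f‖ + ‖F‖) * ‖v‖ := by
  rw [loadL_apply]
  refine (abs_add_le _ _).trans ?_
  rw [add_mul]
  refine add_le_add ((abs_real_inner_le_norm _ _).trans ?_) ((abs_real_inner_le_norm _ _).trans ?_)
  · exact mul_le_mul_of_nonneg_left (H1.norm_fn_le v) (norm_nonneg _)
  · exact mul_le_mul_of_nonneg_left (H1.norm_wgrad_le v) (norm_nonneg _)

theorem loadL_toH1 (f : L2 O) (F : L2v O) {φ : E d → ℝ} (hφ : IsTest O φ) :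
    loadL f F hφ.toH1 = ∫ x in O, (f x * φ x + inner ℝ (F x) (gradient φ x)) := by
  have i1 : Integrable (fun x => f x * φ x) (volume.restrict O) :=
    (Lp.memLp f).integrable_mul hφ.memLp
  have i2 : Integrable (fun x => (inner ℝ (F x) (gradient φ x) : ℝ)) (volume.restrict O) := by
    refine (L2.integrable_inner (𝕜 := ℝ) F (wgrad hφ.toH1)).congr ?_
    filter_upwards [hφ.wgrad_toH1] with x hx
    rw [hx]
  rw [loadL_apply, integral_add i1 i2, inner_eq_integral (ae_eq_refl _) hφ.fn_toH1,
    inner_eq_integral (ae_eq_refl _) hφ.wgrad_toH1]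
  simp only [RCLike.inner_apply, conj_trivial, mul_comm]

theorem isDirichletSolution_iff {a : E d → Matrix (Fin d) (Fin d) ℝ} {f : L2 O} {F : L2v O}
    {u : H1 O} {σ : L2v O} (hσ : σ =ᵐ[volume.restrict O] fun x => mulVecE (a x) (wgrad u x)) :
    IsDirichletSolution a f F u ↔
      u ∈ H10 O ∧ ∀ v ∈ H10 O, inner ℝ σ (wgrad v) = loadL f F v := by
  have key : ∀ (φ : E d → ℝ) (hφ : IsTest O φ), (inner ℝ σ (wgrad hφ.toH1) : ℝ)
      = ∫ x in O, inner ℝ (mulVecE (a x) (wgrad u x)) (gradient φ x) := fun φ hφ =>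
    inner_eq_integral hσ hφ.wgrad_toH1
  constructor
  · intro h
    refine ⟨h.mem_H10, forall_mem_H10_of_isTest (continuous_const.inner wgradL.continuous)
      (loadL f F).continuous fun φ hφ => ?_⟩
    exact (key φ hφ).trans ((h.equation φ hφ).trans (loadL_toH1 f F hφ).symm)
  · rintro ⟨h1, h2⟩
    refine ⟨h1, fun φ hφ => ?_⟩
    rw [← key φ hφ, ← loadL_toH1 f F hφ]
    exact h2 _ hφ.toH1_mem

theorem H1.norm_sq_le_of_poincare {P : ℝ} {u : H1 O} (h : ‖fn u‖ ≤ P * ‖wgrad u‖) :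
    ‖u‖ ^ 2 ≤ (P ^ 2 + 1) * ‖wgrad u‖ ^ 2 := by
  rw [H1.norm_sq]
  have := pow_le_pow_left₀ (norm_nonneg _) h 2
  nlinarith

/-- Lax–Milgram for the form ⟨T D u, D v⟩, with coercivity constant c/C. The operator T need not be
symmetric. -/
theorem existsUnique_of_coercive {V K : Type*} [NormedAddCommGroup V] [InnerProductSpace ℝ V]
    [CompleteSpace V] [NormedAddCommGroup K] [InnerProductSpace ℝ K] (D : V →L[ℝ] K)
    (T : K →L[ℝ] K) {c C : ℝ} (hc : 0 < c) (hC : 0 < C) (hT : ∀ G, c * ‖G‖ ^ 2 ≤ inner ℝ (T G) G)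
    (hD : ∀ u, ‖u‖ ^ 2 ≤ C * ‖D u‖ ^ 2) (ℓ : V →L[ℝ] ℝ) :
    ∃! u : V, ∀ v, inner ℝ (T (D u)) (D v) = ℓ v := by
  let B : V →L[ℝ] V →L[ℝ] ℝ := (innerSL ℝ).bilinearComp (T.comp D) D
  have hB : ∀ u v : V, B u v = inner ℝ (T (D u)) (D v) := fun _ _ => rfl
  have hco : IsCoercive B := by
    refine ⟨c / C, by positivity, fun u => ?_⟩
    rw [hB, mul_assoc, ← sq, div_mul_eq_mul_div, div_le_iff₀ hC]
    calc c * ‖u‖ ^ 2 ≤ c * (C * ‖D u‖ ^ 2) := by gcongr; exact hD u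
      _ = c * ‖D u‖ ^ 2 * C := by ring
      _ ≤ _ := by gcongr; exact hT _
  let r : V := (InnerProductSpace.toDual ℝ _).symm ℓ
  have hr : ∀ v : V, inner ℝ r v = ℓ v := fun v => InnerProductSpace.toDual_symm_apply
  have hiff : ∀ u : V, (∀ v, inner ℝ (T (D u)) (D v) = ℓ v) ↔
      r = hco.continuousLinearEquivOfBilin u := by
    intro u
    constructor
    · intro h
      refine hco.unique_continuousLinearEquivOfBilin fun v => ?_
      rw [hr, hB, h v]
    · intro h v
      have := hco.continuousLinearEquivOfBilin_apply u v
      rw [← h, hr, hB] at this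
      exact this.symm
  refine ⟨hco.continuousLinearEquivOfBilin.symm r, (hiff _).2 (by simp), fun u h => ?_⟩
  rw [(hiff u).1 h]
  simp

theorem existsUnique_mem_of_coercive {H K : Type*} [NormedAddCommGroup H] [InnerProductSpace ℝ H]
    [CompleteSpace H] [NormedAddCommGroup K] [InnerProductSpace ℝ K] (V : Submodule ℝ H)
    (hV : IsClosed (V : Set H)) (D : H →L[ℝ] K)
    (T : K →L[ℝ] K) {c C : ℝ} (hc : 0 < c) (hC : 0 < C) (hT : ∀ G, c * ‖G‖ ^ 2 ≤ inner ℝ (T G) G)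
    (hD : ∀ u ∈ V, ‖u‖ ^ 2 ≤ C * ‖D u‖ ^ 2) (ℓ : H →L[ℝ] ℝ) :
    ∃! u : H, u ∈ V ∧ ∀ v ∈ V, inner ℝ (T (D u)) (D v) = ℓ v := by
  have : CompleteSpace V := hV.completeSpace_coe
  obtain ⟨u, hu, huniq⟩ := existsUnique_of_coercive (D.comp V.subtypeL) T hc hC hT
    (fun u => hD u.1 u.2) (ℓ.comp V.subtypeL)
  refine ⟨u.1, ⟨u.2, fun v hv => hu ⟨v, hv⟩⟩, ?_⟩
  rintro w ⟨hw, h⟩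
  exact congrArg Subtype.val (huniq ⟨w, hw⟩ fun v => h v.1 v.2)

theorem existsUnique_variational (hd : 1 ≤ d) (hOb : Bornology.IsBounded O)
    {T : L2v O →L[ℝ] L2v O} {c : ℝ} (hc : 0 < c) (hT : ∀ G, c * ‖G‖ ^ 2 ≤ inner ℝ (T G) G)
    (ℓ : H1 O →L[ℝ] ℝ) :
    ∃! u : H1 O, u ∈ H10 O ∧ ∀ v ∈ H10 O, inner ℝ (T (wgrad u)) (wgrad v) = ℓ v := by
  obtain ⟨P, hP, hpoin⟩ := exists_poincare hd hOb
  exact existsUnique_mem_of_coercive (H10Submodule O) isClosed_closure wgradL T hc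
    (C := P ^ 2 + 1) (by positivity) hT (fun u hu => H1.norm_sq_le_of_poincare (hpoin u hu)) ℓ

/-- Energy estimate: u is its own test function. The bound depends on the coefficients only through
c, hence is uniform in ε. -/
theorem norm_le_of_variational {P c : ℝ} (hc : 0 < c) {f : L2 O} {F : L2v O} {u : H1 O} {σ : L2v O}
    (hσ : c * ‖wgrad u‖ ^ 2 ≤ inner ℝ σ (wgrad u)) (hP : ‖fn u‖ ≤ P * ‖wgrad u‖)
    (hu : inner ℝ σ (wgrad u) = loadL f F u) :
    ‖u‖ ≤ (P ^ 2 + 1) * (‖f‖ + ‖F‖) / c := by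
  rcases (norm_nonneg u).eq_or_lt with h0 | h0
  · rw [← h0]; positivity
  have h1 := H1.norm_sq_le_of_poincare hP
  have h2 := (le_abs_self _).trans (abs_loadL_le f F u)
  rw [le_div_iff₀ hc]
  refine le_of_mul_le_mul_right ?_ h0
  calc ‖u‖ * c * ‖u‖ = c * ‖u‖ ^ 2 := by ring
    _ ≤ c * ((P ^ 2 + 1) * ‖wgrad u‖ ^ 2) := by gcongr
    _ = (P ^ 2 + 1) * (c * ‖wgrad u‖ ^ 2) := by ring
    _ ≤ (P ^ 2 + 1) * ((‖f‖ + ‖F‖) * ‖u‖) :=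
        mul_le_mul_of_nonneg_left (by linarith) (by positivity)
    _ = _ := by ring

/-! ### Compensated compactness -/

/-- Local Rellich without boundary condition. With z = g n − g₀ and θ = |∇φ|², which is again a test
function, ‖z∇φ‖² = ⟨z, θz⟩. Here θz lies in `H10 O` and converges strongly to 0, while z converges
weakly. -/
theorem tendsto_smul_gradient (hO : IsOpen O) (hOb : Bornology.IsBounded O) {φ : E d → ℝ}
    (hφ : IsTest O φ) {R : L2 O →L[ℝ] L2v O}
    (hR : ∀ f, R f =ᵐ[volume.restrict O] fun x => f x • gradient φ x)
    {g : ℕ → H1 O} {g₀ : H1 O} (hg : WeaklyTendsto g atTop g₀) :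
    Tendsto (fun n => R (fn (g n))) atTop (𝓝 (R (fn g₀))) := by
  set θ : E d → ℝ := fun x => inner ℝ (gradient φ x) (gradient φ x) with hθd
  have hsm : ContDiff ℝ ∞ (gradient φ) :=
    (InnerProductSpace.toDual ℝ (E d)).symm.contDiff.comp
      (hφ.smooth.fderiv_right (m := ∞) (by simp))
  have hsupp : Function.support θ ⊆ tsupport φ := fun x hx => by
    by_contra hx'
    refine hx ?_
    have : gradient φ x = 0 := gradient_eq_zero_of_fderiv_eq_zero
      (by_contra fun hne => hx' (support_fderiv_subset ℝ hne))
    simp [hθd, this]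
  have hθ : IsTest O θ := ⟨hsm.inner ℝ hsm, hφ.compact.mono' hsupp,
    (closure_minimal hsupp (isClosed_tsupport _)).trans hφ.support⟩
  obtain ⟨M, hM⟩ := exists_mul_clm hθ
  have hMmem : ∀ v, M v ∈ H10 O := fun v => mem_H10_of_ae_eq_mul hO hθ (hM v).1 (hM v).2
  have hsq : ∀ v : H1 O, inner ℝ (fn v) (fn (M v)) = ‖R (fn v)‖ ^ 2 := by
    intro v
    rw [← real_inner_self_eq_norm_sq, inner_eq_integral (hR _) (hR _),
      inner_eq_integral (ae_eq_refl _) (hM v).1]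
    refine integral_congr_ae (Eventually.of_forall fun x => ?_)
    simp only [RCLike.inner_apply, conj_trivial, real_inner_smul_left, real_inner_smul_right, hθd]
    ring
  have hz : WeaklyTendsto (fun n => g n - g₀) atTop 0 := by
    have := hg.sub (weaklyTendsto_of_tendsto tendsto_const_nhds (x₀ := g₀))
    rwa [sub_self] at this
  have h1 : Tendsto (fun n => fn (M (g n - g₀))) atTop (𝓝 (fn (M 0))) :=
    tendsto_fn_of_mem_H10 hOb (fun n => hMmem _) (hMmem _) (hz.map M)
  have h2 := (hz.map fnL).inner_tendsto h1
  simp only [fnL_apply, hsq, map_zero, inner_zero_left] at h2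
  have h3 : Tendsto (fun n => ‖R (fn (g n - g₀))‖) atTop (𝓝 0) := by
    have := h2.sqrt
    simpa [Real.sqrt_sq (norm_nonneg _)] using this
  rw [tendsto_iff_norm_sub_tendsto_zero]
  refine h3.congr fun n => ?_
  rw [← fnL_apply, map_sub, map_sub, fnL_apply, fnL_apply]

/-- Compensated compactness: `hsym` cancels the products of gradients, `hid` keeps only terms with
∇φ and the load, and these converge. Adding the limit equations tested with φg₀ and φw restores the
products of gradients at the limit. -/
theorem inner_smul_limit_eq (hO : IsOpen O) (hOb : Bornology.IsBounded O)
    {a : ℕ → E d → Matrix (Fin d) (Fin d) ℝ} {ℓ : H1 O →L[ℝ] ℝ} {u g : ℕ → H1 O} {w g₀ : H1 O}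
    {s t : ℕ → L2v O} {σ τ : L2v O}
    (huw : WeaklyTendsto u atTop w) (hg : WeaklyTendsto g atTop g₀)
    (hs : ∀ n, s n =ᵐ[volume.restrict O] fun x => mulVecE (a n x) (wgrad (u n) x))
    (ht : ∀ n, t n =ᵐ[volume.restrict O] fun x => mulVecE (a n x)ᵀ (wgrad (g n) x))
    (hsσ : WeaklyTendsto s atTop σ) (htτ : WeaklyTendsto t atTop τ)
    (hequ : ∀ n, ∀ v ∈ H10 O, inner ℝ (s n) (wgrad v) = ℓ v)
    (heqg : ∀ n, ∀ v ∈ H10 O, inner ℝ (t n) (wgrad v) = 0)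
    {φ : E d → ℝ} (hφ : IsTest O φ) {S : L2v O →L[ℝ] L2v O}
    (hS : ∀ G, S G =ᵐ[volume.restrict O] fun x => φ x • G x) :
    inner ℝ σ (S (wgrad g₀)) = inner ℝ τ (S (wgrad w)) := by
  obtain ⟨M, hM⟩ := exists_mul_clm hφ
  obtain ⟨R, hR⟩ := exists_smul_gradient_clm hφ
  have hMmem : ∀ v, M v ∈ H10 O := fun v => mem_H10_of_ae_eq_mul hO hφ (hM v).1 (hM v).2
  have hMw : ∀ v, wgrad (M v) = S (wgrad v) + R (fn v) := by
    intro v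
    refine Lp.ext ?_
    filter_upwards [(hM v).2, Lp.coeFn_add (S (wgrad v)) (R (fn v)), hS (wgrad v), hR (fn v)]
      with x h1 h2 h3 h4
    rw [h1, h2, Pi.add_apply, h3, h4]
  have hsym : ∀ n, inner ℝ (s n) (S (wgrad (g n))) = inner ℝ (t n) (S (wgrad (u n))) := by
    intro n
    rw [inner_eq_integral (hs n) (hS _), inner_eq_integral (ht n) (hS _)]
    refine integral_congr_ae (Eventually.of_forall fun x => ?_)
    simp only [real_inner_smul_right, inner_mulVecE_transpose]
    rw [real_inner_comm]
  have hid : ∀ n, inner ℝ (s n) (R (fn (g n))) - inner ℝ (t n) (R (fn (u n))) = ℓ (M (g n)) := by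
    intro n
    have h1 := hequ n _ (hMmem (g n))
    have h2 := heqg n _ (hMmem (u n))
    rw [hMw, inner_add_right] at h1 h2
    linarith [hsym n]
  have hσ : ∀ v ∈ H10 O, inner ℝ σ (wgrad v) = ℓ v := fun v hv =>
    tendsto_nhds_unique (hsσ (wgrad v)) (tendsto_const_nhds.congr fun n => (hequ n v hv).symm)
  have hτ : ∀ v ∈ H10 O, inner ℝ τ (wgrad v) = 0 := fun v hv =>
    tendsto_nhds_unique (htτ (wgrad v)) (tendsto_const_nhds.congr fun n => (heqg n v hv).symm)
  have l1 := hsσ.inner_tendsto (tendsto_smul_gradient hO hOb hφ hR hg)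
  have l2 := htτ.inner_tendsto (tendsto_smul_gradient hO hOb hφ hR huw)
  have l3 : Tendsto (fun n => ℓ (M (g n))) atTop (𝓝 (ℓ (M g₀))) := by
    -- Weak convergence in ℝ, paired with 1, is ordinary convergence.
    simpa using (hg.map (ℓ.comp M)) 1
  have hlim := tendsto_nhds_unique (l1.sub l2) (l3.congr fun n => (hid n).symm)
  have h1 := hσ _ (hMmem g₀)
  have h2 := hτ _ (hMmem w)
  rw [hMw, inner_add_right] at h1 h2
  linarith

theorem eq_zero_of_forall_isTest (hO : IsOpen O) (hOb : Bornology.IsBounded O) {h : L2v O}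
    (hh : ∀ (φ : E d → ℝ), IsTest O φ → ∀ i, ∫ x in O, φ x * h x i = 0) : h = 0 := by
  have : IsFiniteMeasure ((volume : Measure (E d)).restrict O) :=
    ⟨by simpa using hOb.measure_lt_top⟩
  have key : ∀ i, ∀ᵐ x ∂(volume.restrict O), h x i = 0 := by
    intro i
    rw [ae_restrict_iff' hO.measurableSet]
    have hint : Integrable (fun x => h x i) (volume.restrict O) :=
      (EuclideanSpace.proj (𝕜 := ℝ) i : E d →L[ℝ] ℝ).integrable_comp
        ((Lp.memLp h).integrable (by norm_num))
    refine hO.ae_eq_zero_of_integral_contDiff_smul_eq_zero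
      (IntegrableOn.locallyIntegrableOn hint) fun φ h1 h2 h3 => ?_
    have ht : IsTest O φ := ⟨h1, h2, h3⟩
    rw [← hh φ ht i, setIntegral_eq_integral_of_forall_compl_eq_zero
      (fun x hx => by simp [ht.eq_zero hx])]
    rfl
  refine Lp.ext ?_
  filter_upwards [ae_all_iff.2 key, Lp.coeFn_zero (E d) 2 (volume.restrict O)] with x h1 h2
  rw [h2]
  ext i
  exact h1 i

/-! ### Convergence of the solutions -/

theorem exists_constant_field_clm (O : Set (E d)) (A : Matrix (Fin d) (Fin d) ℝ) :
    ∃ T : L2v O →L[ℝ] L2v O,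
      ∀ G : L2v O, T G =ᵐ[volume.restrict O] fun x => mulVecE A (G x) := by
  obtain ⟨T, hT, -⟩ := exists_field_clm (O := O) (a := fun _ => A)
    (C := ‖Matrix.toEuclideanCLM (n := Fin d) (𝕜 := ℝ) A‖) (fun i j => aemeasurable_const)
    (Eventually.of_forall fun x ξ => ContinuousLinearMap.le_opNorm _ _)
  exact ⟨T, hT⟩

theorem inner_mulVecE_transpose_single (A : Matrix (Fin d) (Fin d) ℝ) (i : Fin d) (ξ : E d) :
    inner ℝ (mulVecE Aᵀ (EuclideanSpace.single i 1)) ξ = mulVecE A ξ i := by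
  rw [inner_mulVecE_transpose, EuclideanSpace.inner_single_left]
  simp

/-- Compactness of the fluxes: along a weakly convergent sequence of solutions with weakly
convergent fluxes, the limit flux is the homogenized one. -/
theorem limit_flux_eq (hO : IsOpen O) (hOb : Bornology.IsBounded O)
    {a : ℝ → E d → Matrix (Fin d) (Fin d) ℝ} {ahom : Matrix (Fin d) (Fin d) ℝ}
    (hhom : AdmitsHomogenization a ahom) {ℓ : H1 O →L[ℝ] ℝ} {e : ℕ → ℝ}
    (he : Tendsto e atTop (𝓝[>] 0)) (hepos : ∀ n, 0 < e n) {u : ℕ → H1 O} {w : H1 O}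
    {s : ℕ → L2v O} {σ T₀ : L2v O}
    (huw : WeaklyTendsto u atTop w)
    (hs : ∀ n, s n =ᵐ[volume.restrict O] fun x => mulVecE (a (e n) x) (wgrad (u n) x))
    (hsσ : WeaklyTendsto s atTop σ)
    (hequ : ∀ n, ∀ v ∈ H10 O, inner ℝ (s n) (wgrad v) = ℓ v)
    (hT₀ : T₀ =ᵐ[volume.restrict O] fun x => mulVecE ahom (wgrad w x)) :
    σ = T₀ := by
  rw [← sub_eq_zero]
  refine eq_zero_of_forall_isTest hO hOb fun φ hφ i => ?_
  obtain ⟨g, hg1, hg2, hg3⟩ := hhom.exists_oscillating i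
  have hg3' := hg3 O hO hOb
  obtain ⟨S, hS⟩ := exists_smul_clm (O := O) (F := E d) hφ.smooth.continuous hφ.compact
  have hgw : ∀ ε, wgrad ((g ε).restrict O hOb) =ᵐ[volume.restrict O] (g ε).grad := fun ε =>
    ((g ε).memLp_grad_of_isBounded hOb).coeFn_toLp
  have hcw : wgrad ((coord i).restrict O hOb) =ᵐ[volume.restrict O]
      fun _ => EuclideanSpace.single i 1 :=
    ((coord i).memLp_grad_of_isBounded hOb).coeFn_toLp
  have key := inner_smul_limit_eq (a := fun n => a (e n)) (ℓ := ℓ) hO hOb huw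
    (g := fun n => (g (e n)).restrict O hOb) (g₀ := (coord i).restrict O hOb)
    (t := fun n => (hg3'.memLp (e n) (hepos n)).toLp _) (τ := hg3'.memLp_limit.toLp _)
    ((tendsto_toWeakSpace_iff.1 (hg2 O hO hOb)).comp he) hs (fun n => by
      filter_upwards [(hg3'.memLp (e n) (hepos n)).coeFn_toLp, hgw (e n)] with x h1 h2
      rw [h1, h2]) hsσ (fun y => by
      have := (hg3'.tendsto y (Lp.memLp y)).comp he
      rw [inner_eq_integral hg3'.memLp_limit.coeFn_toLp (ae_eq_refl _)]
      refine this.congr fun n => ?_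
      rw [inner_eq_integral (hg3'.memLp (e n) (hepos n)).coeFn_toLp (ae_eq_refl _)]
      rfl) hequ (fun n => by
      -- A test function on O is also one on the whole space, so the global equation for g restricts
      -- to O; density extends it to `H10 O`.
      refine forall_mem_H10_of_isTest (continuous_const.inner wgradL.continuous)
        continuous_const fun ψ hψ => ?_
      rw [inner_eq_integral (hg3'.memLp (e n) (hepos n)).coeFn_toLp hψ.wgrad_toH1,
        setIntegral_eq_integral_of_forall_compl_eq_zero
          (fun x hx => by simp [hψ.gradient_eq_zero hx])]
      exact hg1 (e n) (hepos n) ψ ⟨hψ.smooth, hψ.compact, Set.subset_univ _⟩) hφ hS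
  have k1 : inner ℝ σ (S (wgrad ((coord i).restrict O hOb))) = ∫ x in O, φ x * σ x i := by
    rw [inner_eq_integral (ae_eq_refl _) (hS _)]
    refine integral_congr_ae ?_
    filter_upwards [hcw] with x h1
    rw [h1, real_inner_smul_right, EuclideanSpace.inner_single_right]
    simp
  have k2 : inner ℝ (hg3'.memLp_limit.toLp _) (S (wgrad w)) = ∫ x in O, φ x * T₀ x i := by
    rw [inner_eq_integral hg3'.memLp_limit.coeFn_toLp (hS _)]
    refine integral_congr_ae ?_
    filter_upwards [hT₀] with x h1
    rw [h1, real_inner_smul_right, inner_mulVecE_transpose_single]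
  have hint : ∀ h : L2v O, Integrable (fun x => φ x * h x i) (volume.restrict O) := fun h =>
    hφ.memLp.integrable_mul ((EuclideanSpace.proj (𝕜 := ℝ) i : E d →L[ℝ] ℝ).comp_memLp h)
  have k3 : ∫ x in O, φ x * (σ - T₀) x i = ∫ x in O, (φ x * σ x i - φ x * T₀ x i) := by
    refine integral_congr_ae ?_
    filter_upwards [Lp.coeFn_sub σ T₀] with x hx
    rw [hx, Pi.sub_apply, PiLp.sub_apply, mul_sub]
  rw [k3, integral_sub (hint σ) (hint T₀), ← k1, ← k2, key, sub_self]

theorem WeaklyTendsto.mem_H10 {u : ℕ → H1 O} {w : H1 O} (h : WeaklyTendsto u atTop w)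
    (hu : ∀ n, u n ∈ H10 O) : w ∈ H10 O :=
  h.mem_of_isClosed (H10Submodule O) isClosed_closure hu

/-- The filter of right neighbourhoods of 0 is countably generated, so sub-subsequences decide
convergence. Dropping the first N terms makes all parameters positive, where the hypotheses on the
coefficients apply. -/
theorem tendsto_nhdsGT_of_subseq {x : ℝ → ℝ} {l : Filter ℝ}
    (h : ∀ e : ℕ → ℝ, Tendsto e atTop (𝓝[>] 0) → (∀ n, 0 < e n) →
      ∃ m : ℕ → ℕ, Tendsto (fun n => x (e (m n))) atTop l) :
    Tendsto x (𝓝[>] 0) l := by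
  refine tendsto_of_subseq_tendsto fun e he => ?_
  obtain ⟨N, hN⟩ := eventually_atTop.1 (he.eventually self_mem_nhdsWithin)
  obtain ⟨m, hm⟩ := h (fun n => e (n + N)) (he.comp (tendsto_add_atTop_nat N))
    fun n => hN _ (Nat.le_add_left _ _)
  exact ⟨fun n => m n + N, hm⟩

/-- Every sequence `e n ↓ 0` has a subsequence along which solutions and fluxes converge to the
homogenized ones. -/
theorem exists_subseq_tendsto (hd : 1 ≤ d) (hO : IsOpen O) (hOb : Bornology.IsBounded O)
    {lam : ℝ} (hlam : 0 < lam) {a : ℝ → E d → Matrix (Fin d) (Fin d) ℝ}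
    {ahom : Matrix (Fin d) (Fin d) ℝ} (hhom : AdmitsHomogenization a ahom)
    {f : L2 O} {F : L2v O} {T : ℝ → L2v O →L[ℝ] L2v O}
    (hT : ∀ ε, 0 < ε → ∀ G : L2v O, T ε G =ᵐ[volume.restrict O] fun x => mulVecE (a ε x) (G x))
    (hTb : ∀ ε, 0 < ε → ∀ G, ‖T ε G‖ ≤ ‖G‖)
    (hTc : ∀ ε, 0 < ε → ∀ G, lam * ‖G‖ ^ 2 ≤ inner ℝ (T ε G) G)
    {T₀ : L2v O →L[ℝ] L2v O}
    (hT₀ : ∀ G : L2v O, T₀ G =ᵐ[volume.restrict O] fun x => mulVecE ahom (G x))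
    {u : ℝ → H1 O} {u₀ : H1 O} (hu : ∀ ε, 0 < ε → IsDirichletSolution (a ε) f F (u ε))
    (hu₀ : IsDirichletSolution (fun _ => ahom) f F u₀)
    (huniq : ∀ v : H1 O, IsDirichletSolution (fun _ => ahom) f F v → v = u₀)
    {e : ℕ → ℝ} (he : Tendsto e atTop (𝓝[>] 0)) (hepos : ∀ n, 0 < e n) :
    ∃ m : ℕ → ℕ, WeaklyTendsto (fun n => u (e (m n))) atTop u₀ ∧
      WeaklyTendsto (fun n => T (e (m n)) (wgrad (u (e (m n))))) atTop (T₀ (wgrad u₀)) := by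
  obtain ⟨P, hP, hpoin⟩ := exists_poincare hd hOb
  have hvar := fun ε (hε : 0 < ε) => (isDirichletSolution_iff (hT ε hε (wgrad (u ε)))).1 (hu ε hε)
  have hb : ∀ n, ‖u (e n)‖ ≤ (P ^ 2 + 1) * (‖f‖ + ‖F‖) / lam := fun n =>
    norm_le_of_variational hlam (hTc _ (hepos n) _) (hpoin _ (hvar _ (hepos n)).1)
      ((hvar _ (hepos n)).2 _ (hvar _ (hepos n)).1)
  obtain ⟨w, m₁, hm₁, hw⟩ := exists_subseq_weaklyTendsto hb
  obtain ⟨σ, m₂, hm₂, hσ⟩ := exists_subseq_weaklyTendsto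
    (x := fun n => T (e (m₁ n)) (wgrad (u (e (m₁ n)))))
    (fun n => (hTb _ (hepos _) _).trans ((H1.norm_wgrad_le _).trans (hb _)))
  have hw' : WeaklyTendsto (fun n => u (e (m₁ (m₂ n)))) atTop w := hw.comp hm₂.tendsto_atTop
  have hσeq : σ = T₀ (wgrad w) := limit_flux_eq hO hOb hhom (ℓ := loadL f F)
    (e := fun n => e (m₁ (m₂ n)))
    (he.comp (hm₁.tendsto_atTop.comp hm₂.tendsto_atTop)) (fun n => hepos _) hw'
    (fun n => hT _ (hepos _) _) hσ (fun n => (hvar _ (hepos _)).2) (hT₀ _)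
  -- The equation for a fixed v is linear in the flux, so it survives the weak limit. With the limit
  -- flux identified, w solves the homogenized problem.
  have hwu : w = u₀ := by
    refine huniq w ((isDirichletSolution_iff (hT₀ (wgrad w))).2
      ⟨hw'.mem_H10 fun n => (hvar _ (hepos _)).1, fun v hv => ?_⟩)
    rw [← hσeq]
    exact tendsto_nhds_unique (hσ (wgrad v))
      (tendsto_const_nhds.congr fun n => ((hvar _ (hepos _)).2 v hv).symm)
  subst hwu
  exact ⟨fun n => m₁ (m₂ n), hw', hσeq ▸ hσ⟩

theorem existsUnique_isDirichletSolution (hd : 1 ≤ d) (hOb : Bornology.IsBounded O)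
    {a : E d → Matrix (Fin d) (Fin d) ℝ} {T : L2v O →L[ℝ] L2v O}
    (hT : ∀ G : L2v O, T G =ᵐ[volume.restrict O] fun x => mulVecE (a x) (G x))
    {c : ℝ} (hc : 0 < c)
    (ha : ∀ᵐ x ∂(volume : Measure (E d)), ∀ ξ : E d,
      c * ‖ξ‖ ^ 2 ≤ inner ℝ ξ (mulVecE (a x) ξ)) (f : L2 O) (F : L2v O) :
    ∃! u : H1 O, IsDirichletSolution a f F u := by
  simp only [fun u : H1 O => isDirichletSolution_iff (f := f) (F := F) (hT (wgrad u))]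
  exact existsUnique_variational hd hOb hc (fun G => mul_norm_sq_le_inner ha (hT G)) (loadL f F)

end Homogenization

end

/-! ### The homogenization theorem -/

theorem lemma2 {d : ℕ} (hd : 1 ≤ d) {lam : ℝ} (hlam : 0 < lam)
    (a : ℝ → Homogenization.E d → Matrix (Fin d) (Fin d) ℝ)
    (ha : ∀ ε : ℝ, 0 < ε → Homogenization.UniformlyElliptic lam (a ε))
    (ahom : Matrix (Fin d) (Fin d) ℝ)
    (hhom : Homogenization.AdmitsHomogenization a ahom)
    (O : Set (Homogenization.E d)) (hO : IsOpen O) (hOb : Bornology.IsBounded O)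
    (f : Homogenization.L2 O) (F : Homogenization.L2v O) :
    (∀ ε : ℝ, 0 < ε → ∃! u : Homogenization.H1 O,
      Homogenization.IsDirichletSolution (a ε) f F u) ∧
    (∃! u₀ : Homogenization.H1 O,
      Homogenization.IsDirichletSolution (fun _ => ahom) f F u₀) ∧
    ∀ (u : ℝ → Homogenization.H1 O) (u₀ : Homogenization.H1 O),
      (∀ ε : ℝ, 0 < ε → Homogenization.IsDirichletSolution (a ε) f F (u ε)) →
      Homogenization.IsDirichletSolution (fun _ => ahom) f F u₀ →
        Homogenization.TendstoWeaklyH1 u u₀ ∧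
        Homogenization.TendstoWeaklyL2 O
          (fun ε x => Homogenization.mulVecE (a ε x) (Homogenization.wgrad (u ε) x))
          (fun x => Homogenization.mulVecE ahom (Homogenization.wgrad u₀ x)) := by
  open Homogenization in
  have hex : ∀ ε : ℝ, ∃ T : L2v O →L[ℝ] L2v O, 0 < ε →
      (∀ G : L2v O, T G =ᵐ[volume.restrict O] fun x => mulVecE (a ε x) (G x)) ∧
      ∀ G, ‖T G‖ ≤ ‖G‖ := by
    intro ε
    by_cases hε : 0 < ε
    · obtain ⟨T, hT, hTb⟩ := exists_field_clm (O := O) (C := 1) (ha ε hε).measurable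
        ((ha ε hε).bounds.mono fun x hx ξ => by simpa using (hx ξ).2)
      exact ⟨T, fun _ => ⟨hT, by simpa using hTb⟩⟩
    -- For ε ≤ 0 nothing is assumed; the value 0 only makes T total.
    · exact ⟨0, fun h => absurd h hε⟩
  choose T hT using hex
  have hell : ∀ ε : ℝ, 0 < ε → ∀ᵐ x ∂(volume : Measure (Homogenization.E d)),
      ∀ ξ : Homogenization.E d, lam * ‖ξ‖ ^ 2 ≤ inner ℝ ξ (Homogenization.mulVecE (a ε x) ξ) :=
    fun ε hε => (ha ε hε).bounds.mono fun x hx ξ => (hx ξ).1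
  obtain ⟨T₀, hT₀⟩ := Homogenization.exists_constant_field_clm O ahom
  obtain ⟨μ, hμ, hμell⟩ := hhom.elliptic
  have hhomex := Homogenization.existsUnique_isDirichletSolution hd hOb hT₀ hμ
    (Eventually.of_forall fun _ => hμell) f F
  refine ⟨fun ε hε => Homogenization.existsUnique_isDirichletSolution hd hOb (hT ε hε).1 hlam
    (hell ε hε) f F, hhomex, fun u u₀ hu hu₀ => ?_⟩
  have hsub := fun (e : ℕ → ℝ) (he : Tendsto e atTop (𝓝[>] 0)) (hepos : ∀ n, 0 < e n) =>
    Homogenization.exists_subseq_tendsto hd hO hOb hlam hhom (fun ε hε => (hT ε hε).1)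
      (fun ε hε => (hT ε hε).2)
      (fun ε hε G => Homogenization.mul_norm_sq_le_inner (hell ε hε) ((hT ε hε).1 G)) hT₀ hu hu₀
      (fun v hv => hhomex.unique hv hu₀) he hepos
  have hmem : ∀ ε : ℝ, 0 < ε → MemLp
      (fun x => Homogenization.mulVecE (a ε x) (Homogenization.wgrad (u ε) x)) 2
      (volume.restrict O) := fun ε hε => (Lp.memLp _).ae_eq ((hT ε hε).1 _)
  refine ⟨Homogenization.tendsto_toWeakSpace_iff.2 fun y =>
    Homogenization.tendsto_nhdsGT_of_subseq fun e he hepos => ?_,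
    hmem, (Lp.memLp _).ae_eq (hT₀ _), fun ψ hψ => ?_⟩
  · obtain ⟨m, hm, -⟩ := hsub e he hepos
    exact ⟨m, hm y⟩
  · have h1 : Tendsto (fun ε => inner ℝ (T ε (Homogenization.wgrad (u ε))) (hψ.toLp ψ)) (𝓝[>] 0)
        (𝓝 (inner ℝ (T₀ (Homogenization.wgrad u₀)) (hψ.toLp ψ))) :=
      Homogenization.tendsto_nhdsGT_of_subseq fun e he hepos => by
        obtain ⟨m, -, hm⟩ := hsub e he hepos
        exact ⟨m, hm _⟩
    rw [Homogenization.inner_eq_integral (hT₀ _) hψ.coeFn_toLp] at h1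
    refine h1.congr' ?_
    filter_upwards [self_mem_nhdsWithin] with ε hε
    exact Homogenization.inner_eq_integral ((hT ε hε).1 _) hψ.coeFn_toLp
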